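/- **Setting.** Let $n>1$ and let $\mathcal T$ be a torus divided into $n$ annular rows by $n$ horizontal circles and into $n$ annular columns by $n$ vertical circles, with $n$ markings $O_1,\dots,O_n$ (and associated variables $U_1,\dots,U_n$), exactly one in each row and in each column; this is a toroidal grid diagram $G$ of size $n$. Let $\mathcal Z=\{O_{i_1},\dots,O_{i_k}\}$ be a set of $k$ of the $O$'s, marked for destabilization; the lower left corner $p_j$ of the square of $O_{i_j}$ is called a destabilization point. Assume that $(G,\mathcal Z)$ is *sparse*: no two of the $O$'s in $\mathcal Z$ lie in adjacent rows or in adjacent columns (adjacency on the torus, i.e. cyclic). Let $\mathbf S(G)$ be the set of matchings between horizontal and vertical circles (viewed as $n$-tuples of intersection points) with its Maslov grading $M$, and let $\mathbf S(G^{\mathcal Z})\subset \mathbf S(G)$ consist of those containing all $p_j$. Put $\mathbb F=\mathbb Z/2$, $\mathcal R=\mathbb F[[U_1,\dots,U_n]]$. Let $C^-(G)$ be the free $\mathcal R$-module on $\mathbf S(G)$ with differential counting empty rectangles $r$ on the torus with weight $\prod_i U_i^{O_i(r)}$. Let $EC^-(G,\mathcal Z)$ be the free $\mathcal R$-module on the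 pairs $(\mathbf y,\epsilon)$, $\mathbf y\in \mathbf S(G^{\mathcal Z})$, $\epsilon\in\{0,1\}^k$, with differential $$\partial(\mathbf y,\epsilon)=\sum_{\mathbf y'}\sum_r \prod_{O_i\notin\mathcal Z}U_i^{O_i(r)}(\mathbf y',\epsilon)+\sum_{j:\,\epsilon_j=0}(U_{i_j}-U_{i_j'})(\mathbf y,\epsilon+e_j),$$ where $r$ runs over the empty rectangles from $\mathbf y$ to $\mathbf y'$ in the destabilized diagram $G^{\mathcal Z}$ (the horizontal and vertical circles through the $p_j$ and the markings in $\mathcal Z$ are removed), and $O_{i_j'}$ is the $O$ in the row directly below $p_j$. Set $M(U_1^{N_1}\cdots U_n^{N_n}(\mathbf y,\epsilon))=M(\mathbf y)+\sum_j\epsilon_j-2\sum_iN_i$, where $M(\mathbf y)$ is the grading of $\mathbf y$ as an element of $\mathbf S(G)$. The complex $\mathrm{Hom}_{\mathcal R}(C^-(G),EC^-(G,\mathcal Z))$ has as generators over $\mathbb F$ the pairs $[\mathbf x,\tilde{\mathbf y}]$ with $\mathbf x\in \mathbf S(G)$, $\tilde{\mathbf y}=U_1^{N_1}\cdots U_n^{N_n}(\mathbf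 y,\epsilon)$ ($N_i\ge0$), in degree $M(\mathbf x)-M(\tilde{\mathbf y})$, and its differential $d[\mathbf x,\tilde{\mathbf y}]=[\partial^*\mathbf x,\tilde{\mathbf y}]+[\mathbf x,\partial\tilde{\mathbf y}]$ raises the degree by one. An *enhanced domain* is a triple $(D,\epsilon,\rho)$: an integral combination $D$ of squares forming a domain from some $\mathbf x\in \mathbf S(G)$ to some $\mathbf y\in \mathbf S(G^{\mathcal Z})$, $\epsilon\in\{0,1\}^k$ and $\rho\in\mathbb Z^k$. It goes from $\mathbf x$ to $U_1^{N_1}\cdots U_n^{N_n}(\mathbf y,\epsilon)$, where $N_{i_j}=\rho_j$ and $N_i$ is the multiplicity $O_i(D)$ of $D$ at $O_i$ if $O_i\notin\mathcal Z$. Put $f_j=O_{i_j}(D)-\rho_j$ and let $a_j,b_j,c_j,d_j$ be the multiplicities of $D$ in the upper left, upper right, lower left and lower right squares at $p_j$. The enhanced domain is *positive* if all multiplicities of $D$ are nonnegative and $a_j\ge f_j$, $b_j\ge f_j$, $c_j\ge f_j+\epsilon_j-1$, $d_j\ge f_j+\epsilon_j$ for all $j$. A pair $[\mathbf x,\tilde{\mathbf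 y}]$ is positive if some positive enhanced domain goes from $\mathbf x$ to $\tilde{\mathbf y}$. **Theorem.** The positive pairs generate a subcomplex $CP^*(G,\mathcal Z)$ of the cochain complex above, and its cohomology $HP^*(G,\mathcal Z)$ satisfies $$HP^d(G,\mathcal Z)=0\qquad\text{for all } d<\min\{0,2-k\}.$$ -/

import Mathlib

/-- A toroidal grid diagram of size `n`, with the `X` markings forgotten and some of its `O`
markings marked for destabilization.

Columns, rows, vertical circles and horizontal circles are indexed cyclically by `Fin n` (addition
and subtraction in `Fin n` are modulo `n`). The square `(i, j)` lies in column `i` and row `j`; its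
lower left corner is the intersection of the `i`-th vertical and the `j`-th horizontal circle.
Each row and each column contains exactly one `O`: the one in column `i` lies in row `O i`, and
is called `O_i` below. The set `Z` consists of the (columns of the) `O`'s that are marked for
destabilization. The destabilization point of `c ∈ Z` is the lower left corner `(c, O c)` of the
square of `O_c`. -/
structure MarkedGrid (n : ℕ) where
  O : Equiv.Perm (Fin n)
  Z : Finset (Fin n)

namespace MarkedGrid

/-- No two of the `O`'s marked for destabilization sit in adjacent rows or in adjacent columns.
Adjacency is cyclic, since rows and columns are annuli on the torus. -/
def IsSparse {n : ℕ} [NeZero n] (G : MarkedGrid n) : Prop :=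
  ∀ c ∈ G.Z, ∀ c' ∈ G.Z, c ≠ c' → c' ≠ c + 1 ∧ G.O c' ≠ G.O c + 1

/-- Generators of the complex of the destabilized diagram, as elements of the set of matchings
between horizontal and vertical circles (`x` consists of the points `(i, x i)`): those that contain
all the destabilization points. -/
abbrev DestabState {n : ℕ} (G : MarkedGrid n) : Type :=
  {y : Equiv.Perm (Fin n) // ∀ c ∈ G.Z, y c = G.O c}

/-- The Maslov grading `J(x,x) - 2 J(x,O) + J(O,O) + 1` of a matching, where `J` is the
symmetrization of the number of pairs `(p, q)` with `p` strictly to the left of and strictly below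
`q`, in the fundamental domain `[0, n) × [0, n)`; the markings are at the centres of the squares. -/
def maslov {n : ℕ} (G : MarkedGrid n) (x : Equiv.Perm (Fin n)) : ℤ :=
  ((Finset.univ.filter fun p : Fin n × Fin n => p.1 < p.2 ∧ x p.1 < x p.2).card : ℤ)
    - ((Finset.univ.filter fun p : Fin n × Fin n => p.1 ≤ p.2 ∧ x p.1 ≤ G.O p.2).card : ℤ)
    - ((Finset.univ.filter fun p : Fin n × Fin n => p.1 < p.2 ∧ G.O p.1 < x p.2).card : ℤ)
    + ((Finset.univ.filter fun p : Fin n × Fin n => p.1 < p.2 ∧ G.O p.1 < G.O p.2).card : ℤ)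
    + 1

/-- The half-open cyclic interval `[a, b)`. -/
def InArc {n : ℕ} [NeZero n] (a b c : Fin n) : Prop := c - a < b - a

instance {n : ℕ} [NeZero n] (a b c : Fin n) : Decidable (InArc a b c) :=
  inferInstanceAs (Decidable (c - a < b - a))

/-- Empty rectangles from `x` to `y` in the diagram from which the vertical circles `i ∈ W`, and the
horizontal circles through the points `(i, x i)`, `i ∈ W`, are removed (`W = ∅` for the original
grid, `W = Z` for the destabilized one). A rectangle is given by the pair `(a, b)` of the
vertical circles containing its left and right edges: its lower left and upper right corners are
`(a, x a)` and `(b, x b)`, it goes to the right from `a` to `b` and up from `x a` to `x b`, its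
other two corners are in `y`, and the remaining points of `x` and `y` agree. It is empty if its
interior contains no point of `x`. -/
def emptyRect {n : ℕ} [NeZero n] (W : Finset (Fin n)) (x y : Equiv.Perm (Fin n)) :
    Finset (Fin n × Fin n) :=
  Finset.univ.filter fun r =>
    r.1 ≠ r.2 ∧ r.1 ∉ W ∧ r.2 ∉ W ∧ y = x * Equiv.swap r.1 r.2 ∧
      ∀ i, i ∉ W → ¬ ((i ≠ r.1 ∧ InArc r.1 r.2 i) ∧ (x i ≠ x r.1 ∧ InArc (x r.1) (x r.2) (x i)))

/-- The multiplicities, at the `O`'s whose columns are not in `W`, of the rectangle `r = (a, b)`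
starting at `x`. -/
def rectO {n : ℕ} [NeZero n] (G : MarkedGrid n) (W : Finset (Fin n)) (x : Equiv.Perm (Fin n))
    (r : Fin n × Fin n) : Fin n → ℕ :=
  fun i => if i ∉ W ∧ InArc r.1 r.2 i ∧ InArc (x r.1) (x r.2) (G.O i) then 1 else 0

/-- The generators `[x, U_1^{N_1} ⋯ U_n^{N_n} (y, ε)]` over `𝔽 = ℤ/2` of the Hom complex
`Hom_R (C⁻(G), EC⁻(G, Z))`, `R = 𝔽[[U_1, …, U_n]]`. The variable `U_i` belongs to `O_i`; the
marking `ε c` is `false` for a left marking (`0`) and `true` for a right marking (`1`). -/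
@[ext]
structure Pair {n : ℕ} (G : MarkedGrid n) where
  x : Equiv.Perm (Fin n)
  y : G.DestabState
  ε : G.Z → Bool
  N : Fin n → ℕ

/-- The index `M(x) - M(U^N (y, ε))`, where `M(y, ε) = M(y) + ∑ ε` and each `U_i` has
degree `-2`. -/
def Pair.index {n : ℕ} {G : MarkedGrid n} (p : G.Pair) : ℤ :=
  G.maslov p.x - (G.maslov p.y.1 + ∑ c, ((p.ε c).toNat : ℤ) - 2 * ∑ i, (p.N i : ℤ))

/-- An enhanced domain: a domain `D` (`D i j` is the multiplicity at the square `(i, j)`) from the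
matching `x` to `y`, where `y` contains the destabilization points, markings `ε`, and real
multiplicities `ρ`. That `D` goes from `x` to `y` means that the boundary of the part of `∂D`
that lies on the horizontal circles is `y - x`. -/
structure EnhancedDomain {n : ℕ} [NeZero n] (G : MarkedGrid n) where
  x : Equiv.Perm (Fin n)
  y : G.DestabState
  D : Fin n → Fin n → ℤ
  boundary : ∀ i j, D (i - 1) j + D i (j - 1) - D i j - D (i - 1) (j - 1) =
    (if y.1 i = j then 1 else 0) - (if x i = j then 1 else 0)
  ε : G.Z → Bool
  ρ : G.Z → ℤ

/-- The fake multiplicity: total multiplicity minus real multiplicity. -/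
def EnhancedDomain.fake {n : ℕ} [NeZero n] {G : MarkedGrid n} (E : G.EnhancedDomain) (c : G.Z) :
    ℤ :=
  E.D c (G.O c) - E.ρ c

/-- The exponents `N_1, …, N_n` in the final point `U_1^{N_1} ⋯ U_n^{N_n} (y, ε)`. -/
def EnhancedDomain.exponent {n : ℕ} [NeZero n] {G : MarkedGrid n} (E : G.EnhancedDomain)
    (i : Fin n) : ℤ :=
  if h : i ∈ G.Z then E.ρ ⟨i, h⟩ else E.D i (G.O i)

/-- Positivity: `D` has nonnegative multiplicities, and for each destabilization point the
multiplicities `a` (upper left), `b` (upper right), `c` (lower left), `d` (lower right) of the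
squares around it satisfy `a ≥ f`, `b ≥ f`, `c ≥ f + ε - 1`, `d ≥ f + ε`. -/
def EnhancedDomain.IsPositive {n : ℕ} [NeZero n] {G : MarkedGrid n} (E : G.EnhancedDomain) :
    Prop :=
  (∀ i j, 0 ≤ E.D i j) ∧
  ∀ c : G.Z,
    E.fake c ≤ E.D (c - 1) (G.O c) ∧
    E.fake c ≤ E.D c (G.O c) ∧
    E.fake c + ((E.ε c).toNat : ℤ) - 1 ≤ E.D (c - 1) (G.O c - 1) ∧
    E.fake c + ((E.ε c).toNat : ℤ) ≤ E.D c (G.O c - 1)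

/-- A pair is positive if some positive enhanced domain has it as its initial and final points. -/
def Pair.IsPositive {n : ℕ} [NeZero n] {G : MarkedGrid n} (p : G.Pair) : Prop :=
  ∃ E : G.EnhancedDomain, E.IsPositive ∧ E.x = p.x ∧ E.y = p.y ∧ E.ε = p.ε ∧
    ∀ i, E.exponent i = (p.N i : ℤ)

/-- There are finitely many pairs of each index; thus in each degree there is no difference
between direct sums and direct products of generators. -/
theorem finite_setOf_index_eq {n : ℕ} (G : MarkedGrid n) (d : ℤ) :
    {p : G.Pair | p.index = d}.Finite := by
  classical
  have key : {p : G.Pair | p.index = d} ⊆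
      ⋃ t : Equiv.Perm (Fin n) × G.DestabState × (G.Z → Bool),
        (fun N : Fin n → ℕ => (⟨t.1, t.2.1, t.2.2, N⟩ : G.Pair)) ''
          Set.Iic (fun _ => (d - G.maslov t.1 + G.maslov t.2.1.1
            + ∑ c, ((t.2.2 c).toNat : ℤ)).toNat) := by
    intro p hp
    simp only [Set.mem_iUnion]
    refine ⟨(p.x, p.y, p.ε), p.N, fun i => ?_, rfl⟩
    have h1 : (p.N i : ℤ) ≤ ∑ i, (p.N i : ℤ) :=
      Finset.single_le_sum (f := fun i => (p.N i : ℤ)) (fun _ _ => by positivity)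
        (Finset.mem_univ i)
    have h2 : p.index = d := hp
    simp only [Pair.index] at h2
    dsimp only
    omega
  exact (Set.finite_iUnion fun t => (Set.finite_Iic _).image _).subset key

/-- The differential of a generator of the Hom complex,
`d [x, ỹ] = [∂* x, ỹ] + [x, ∂ ỹ]`. The first sum is the pre-composition with rectangles, weighted
by all the variables. The second and third are the differential of `EC⁻(G, Z)`, the tensor
product over `c ∈ Z` of the mapping cones of `U_c - U_{c'}` on the complex of the destabilized
diagram, from left to right markings, where `O_{c'}` is the `O` in the row directly below the
destabilization point of `O_c`. Coefficients are in `ℤ/2`. -/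
noncomputable def diffPair {n : ℕ} [NeZero n] (G : MarkedGrid n) (p : G.Pair) :
    G.Pair →₀ ZMod 2 :=
  (∑ x' : Equiv.Perm (Fin n), ∑ r ∈ emptyRect ∅ x' p.x,
      Finsupp.single (⟨x', p.y, p.ε, p.N + G.rectO ∅ x' r⟩ : G.Pair) (1 : ZMod 2))
  + (∑ y' : G.DestabState, ∑ r ∈ emptyRect G.Z p.y.1 y'.1,
      Finsupp.single (⟨p.x, y', p.ε, p.N + G.rectO G.Z p.y.1 r⟩ : G.Pair) (1 : ZMod 2))
  + ∑ c : G.Z, if p.ε c = false then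
      Finsupp.single (⟨p.x, p.y, Function.update p.ε c true,
        p.N + Pi.single (c : Fin n) 1⟩ : G.Pair) (1 : ZMod 2)
      - Finsupp.single (⟨p.x, p.y, Function.update p.ε c true,
        p.N + Pi.single (G.O.symm (G.O c - 1)) 1⟩ : G.Pair) (1 : ZMod 2)
    else 0

/-- The differential of the Hom complex. -/
noncomputable def diff {n : ℕ} [NeZero n] (G : MarkedGrid n) :
    (G.Pair →₀ ZMod 2) →ₗ[ZMod 2] (G.Pair →₀ ZMod 2) :=
  Finsupp.linearCombination (ZMod 2) G.diffPair

/-- The degree `d` part of the complex of positive pairs. -/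
noncomputable def CP {n : ℕ} [NeZero n] (G : MarkedGrid n) (d : ℤ) :
    Submodule (ZMod 2) (G.Pair →₀ ZMod 2) :=
  Finsupp.supported (ZMod 2) (ZMod 2) {p : G.Pair | p.IsPositive ∧ p.index = d}

/-- Cocycles of degree `d` in the complex of positive pairs. -/
noncomputable def cocycles {n : ℕ} [NeZero n] (G : MarkedGrid n) (d : ℤ) :
    Submodule (ZMod 2) (G.Pair →₀ ZMod 2) :=
  G.CP d ⊓ LinearMap.ker G.diff

/-- Coboundaries of degree `d` in the complex of positive pairs, as a subspace of the cocycles. -/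
noncomputable def coboundaries {n : ℕ} [NeZero n] (G : MarkedGrid n) (d : ℤ) :
    Submodule (ZMod 2) (G.cocycles d) :=
  ((G.CP (d - 1)).map G.diff).comap (G.cocycles d).subtype

/-- The cohomology of the complex of positive pairs in degree `d`. -/
abbrev HP {n : ℕ} [NeZero n] (G : MarkedGrid n) (d : ℤ) : Type :=
  G.cocycles d ⧸ G.coboundaries d

end MarkedGrid

/-! ### Cyclic intervals and empty rectangles -/

namespace MarkedGrid

/-! The cohomology vanishes in every negative degree, by an acyclic matching on the positive pairs.
A destabilization point `(c, O c)` is free for `x` if neither point of `x` on the vertical circles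
`c` and `c + 1` lies on its horizontal circle. These two points of `x` cut column `c` into two thin
rectangles. At a free point exactly one of them avoids both rows `O c` and `O c - 1`, and in
particular avoids `O_c`. Moving `x` across it, with no change of the powers of the variables,
matches a pair for which `IsTop` fails with a pair of index one higher for which `IsTop` holds.

Three facts make this work.

A positive pair of negative index has a free point (`Pair.exists_isFree`). By `IsDomain.maslov_sub`,
the index of a domain is a sum of average multiplicities at the points of `x` and `y`, up to the
multiplicities at the `O`'s. If no point is free, the positivity inequalities at the destabilization
points, whose neighbourhoods do not interfere by sparseness, already make the index nonnegative
(`sum_le_index`).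

The lower partner of a positive pair is positive (`Pair.flip_isPositive`): column annuli are added
to the domain and absorbed into the fake multiplicity before the thin rectangle is removed. In the
other direction positivity is preserved because positive pairs form a subcomplex
(`Pair.Arrow.isPositive`).

There is a weight which every term of the differential strictly increases, except for the thin
rectangles of the matching (`Pair.Arrow.weight_lt`). It comes from nonnegative weights of the
squares with constant row and column sums. Annuli then contribute only through the `O` they contain,
so that the weight depends on the pair and not on the domain.

Given a choice of one free point per matching `x`, elimination along the weight moves any cochain of
negative degree, modulo coboundaries, to pairs that are not matched downwards (`CP_le_map_sup`). The
differential is injective on the span of these (`eq_zero_of_diff_eq_zero`). Together with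
`diff_diff`, which follows from the usual juxtaposition of rectangles, this makes every cocycle a
coboundary. -/

theorem inArc_iff {n : ℕ} [NeZero n] (a b c : Fin n) :
    InArc a b c ↔ (a ≤ c ∧ c < b) ∨ (b < a ∧ (a ≤ c ∨ c < b)) := by
  unfold InArc
  obtain ⟨a, ha⟩ := a
  obtain ⟨b, hb⟩ := b
  obtain ⟨c, hc⟩ := c
  simp only [Fin.lt_def, Fin.le_def, Fin.sub_def]
  have key : ∀ u : ℕ, u < n → (n - a + u) % n = if a ≤ u then u - a else n - a + u := by
    intro u hu
    split_ifs with h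
    · rw [show n - a + u = (u - a) + n by omega, Nat.add_mod_right, Nat.mod_eq_of_lt (by omega)]
    · exact Nat.mod_eq_of_lt (by omega)
  rw [key b hb, key c hc]
  split_ifs <;> omega

/-- Empty rectangles starting at `x`, for all targets. -/
def IsEmptyRect {n : ℕ} [NeZero n] (W : Finset (Fin n)) (x : Equiv.Perm (Fin n)) (a b : Fin n) :
    Prop :=
  a ≠ b ∧ a ∉ W ∧ b ∉ W ∧
    ∀ i, i ∉ W → ¬ ((i ≠ a ∧ InArc a b i) ∧ (x i ≠ x a ∧ InArc (x a) (x b) (x i)))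

theorem mem_emptyRect {n : ℕ} [NeZero n] {W : Finset (Fin n)} {x y : Equiv.Perm (Fin n)}
    {r : Fin n × Fin n} :
    r ∈ emptyRect W x y ↔ IsEmptyRect W x r.1 r.2 ∧ y = x * Equiv.swap r.1 r.2 := by
  simp only [emptyRect, IsEmptyRect, Finset.mem_filter, Finset.mem_univ, true_and]
  tauto

end MarkedGrid

/-! ### Exchanging two consecutive empty rectangles -/

namespace MarkedGrid
open Equiv
variable {n : ℕ} [NeZero n]

/-- The open cyclic interval `(a, b)`. -/
def Btw (a b c : Fin n) : Prop := c ≠ a ∧ InArc a b c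

theorem btw_iff (a b c : Fin n) :
    Btw a b c ↔ (a < c ∧ c < b) ∨ (b < a ∧ (a < c ∨ c < b)) := by
  rw [Btw, inArc_iff]; simp only [Fin.lt_def, Fin.le_def, ne_eq, Fin.ext_iff]; omega

theorem Btw.rotate {a b c : Fin n} (h : Btw a b c) : Btw c a b := by
  simp only [btw_iff, Fin.lt_def] at *; omega

theorem Btw.ne {a b c : Fin n} (h : Btw a b c) : a ≠ b ∧ a ≠ c ∧ b ≠ c := by
  simp only [btw_iff, Fin.lt_def, ne_eq, Fin.ext_iff] at *; omega

theorem Btw.asymm {a b c : Fin n} (h : Btw a b c) : ¬ Btw b a c := by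
  simp only [btw_iff, Fin.lt_def] at *; omega

theorem btw_total {a b c : Fin n} (h : a ≠ b) (h' : a ≠ c) (h'' : b ≠ c) :
    Btw a b c ∨ Btw b a c := by
  simp only [btw_iff, Fin.lt_def, ne_eq, Fin.ext_iff] at *; omega

theorem Btw.split {a b c : Fin n} (h : Btw a b c) (i : Fin n) :
    Btw a b i ↔ Btw a c i ∨ i = c ∨ Btw c b i := by
  simp only [btw_iff, Fin.lt_def, Fin.ext_iff] at *; omega

theorem isEmptyRect_iff {W : Finset (Fin n)} {x : Perm (Fin n)} {a b : Fin n} :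
    IsEmptyRect W x a b ↔ a ≠ b ∧ a ∉ W ∧ b ∉ W ∧
      ∀ i, i ∉ W → Btw a b i → ¬ Btw (x a) (x b) (x i) := by
  simp only [IsEmptyRect, Btw, not_and, and_imp]

theorem btw_or {a b c : Fin n} (h : a ≠ b) (h' : a ≠ c) (h'' : b ≠ c) :
    Btw a b c ∨ Btw a c b := by
  simp only [btw_iff, Fin.lt_def, ne_eq, Fin.ext_iff] at *; omega

theorem Btw.not_swap {a b c : Fin n} (h : Btw a b c) : ¬ Btw a c b := by
  simp only [btw_iff, Fin.lt_def] at *; omega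

theorem Btw.inArc_split {a b c : Fin n} (h : Btw a b c) (i : Fin n) :
    InArc a b i ↔ InArc a c i ∨ InArc c b i := by
  simp only [btw_iff, inArc_iff, Fin.lt_def, Fin.le_def] at *; omega

theorem Btw.inArc_disj {a b c : Fin n} (h : Btw a b c) (i : Fin n) :
    InArc a c i → ¬ InArc c b i := by
  simp only [btw_iff, inArc_iff, Fin.lt_def, Fin.le_def] at *; omega

theorem mul_swap_left {n : ℕ} (x : Perm (Fin n)) (a b : Fin n) : (x * swap a b) a = x b := by simp

theorem mul_swap_right {n : ℕ} (x : Perm (Fin n)) (a b : Fin n) : (x * swap a b) b = x a := by simp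

theorem mul_swap_of_ne {n : ℕ} (x : Perm (Fin n)) {a b i : Fin n} (h : i ≠ a) (h' : i ≠ b) :
    (x * swap a b) i = x i := by simp [swap_apply_of_ne_of_ne h h']

section
variable {W : Finset (Fin n)} {x : Perm (Fin n)} {a b d : Fin n}

/-- Two rectangles with exactly one vertical circle in common form an L-shape, which can be cut from
its reentrant corner in two directions; this lemma and the next seven pass from one cut to the other
in the possible positions. In each, emptiness of the given rectangles excludes one of the two cyclic
orders, which gives the `Btw` in the conclusion. That relation identifies the position of the new
cut, so that a second exchange restores the first. -/
theorem exchange_left_inner (hdb : d ≠ b) (h1 : IsEmptyRect W x a b)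
    (h2 : IsEmptyRect W (x * swap a b) a d) (h : Btw a b d) :
    IsEmptyRect W x a d ∧ IsEmptyRect W (x * swap a d) d b ∧ Btw (x a) (x d) (x b) := by
  simp only [isEmptyRect_iff] at *
  obtain ⟨hab, ha, hb, h1⟩ := h1
  obtain ⟨had, -, hd, h2⟩ := h2
  rw [mul_swap_left, mul_swap_of_ne x had.symm hdb] at h2
  rw [mul_swap_right, mul_swap_of_ne x hab.symm hdb.symm]
  have hk : Btw (x a) (x d) (x b) :=
    (btw_or (x.injective.ne had) (x.injective.ne hab) (x.injective.ne hdb)).resolve_right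
      (h1 d hd h)
  refine ⟨⟨had, ha, hd, fun i hi p q => ?_⟩, ⟨hdb, hd, hb, fun i hi p q => ?_⟩, hk⟩
  · have ib : i ≠ b := by rintro rfl; exact h.not_swap p
    rcases (hk.split _).1 q with q | q | q
    · exact h1 i hi ((h.split i).2 (.inl p)) q
    · exact ib (x.injective q)
    · exact h2 i hi p (by rwa [mul_swap_of_ne x p.ne.2.1.symm ib])
  · have ia : i ≠ a := by rintro rfl; exact h.rotate.not_swap p
    rw [mul_swap_of_ne x ia p.ne.2.1.symm] at q
    exact h1 i hi ((h.split i).2 (.inr (.inr p))) q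

theorem exchange_right_inner_row (hda : d ≠ a) (h1 : IsEmptyRect W x a b)
    (h2 : IsEmptyRect W (x * swap a b) b d) (h : Btw (x a) (x b) (x d)) :
    IsEmptyRect W x a d ∧ IsEmptyRect W (x * swap a d) a b ∧ Btw a d b := by
  simp only [isEmptyRect_iff] at *
  obtain ⟨hab, ha, hb, h1⟩ := h1
  obtain ⟨hbd, -, hd, h2⟩ := h2
  rw [mul_swap_right, mul_swap_of_ne x hda hbd.symm] at h2
  rw [mul_swap_left, mul_swap_of_ne x hab.symm hbd]
  have hk : Btw a d b := (btw_or hda.symm hab hbd.symm).resolve_right fun p => h1 d hd p h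
  refine ⟨⟨hda.symm, ha, hd, fun i hi p q => ?_⟩, ⟨hab, ha, hb, fun i hi p q => ?_⟩, hk⟩
  · rcases (hk.split _).1 p with p | rfl | p
    · exact h1 i hi p ((h.split _).2 (.inl q))
    · exact h.not_swap q
    · exact h2 i hi p (by
        rwa [mul_swap_of_ne x (fun e => q.ne.2.1 (by rw [e])) p.ne.2.1.symm])
  · have id : i ≠ d := by rintro rfl; exact hk.not_swap p
    rw [mul_swap_of_ne x p.ne.2.1.symm id] at q
    exact h1 i hi p ((h.split _).2 (.inr (.inr q)))

theorem exchange_left_outer (hdb : d ≠ b) (h1 : IsEmptyRect W x a b)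
    (h2 : IsEmptyRect W (x * swap a b) a d) (h : Btw a d b) :
    IsEmptyRect W x b d ∧ IsEmptyRect W (x * swap b d) a b ∧ Btw (x a) (x d) (x b) := by
  simp only [isEmptyRect_iff] at *
  obtain ⟨hab, ha, hb, h1⟩ := h1
  obtain ⟨had, -, hd, h2⟩ := h2
  have hb2 := h2 b hb h
  rw [mul_swap_left, mul_swap_of_ne x had.symm hdb] at h2 hb2
  rw [mul_swap_right] at hb2
  rw [mul_swap_left, mul_swap_of_ne x hab had]
  have hk : Btw (x a) (x d) (x b) :=
    ((btw_or (x.injective.ne hdb.symm) (x.injective.ne hab.symm)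
      (x.injective.ne had.symm)).resolve_left hb2).rotate.rotate
  refine ⟨⟨hdb.symm, hb, hd, fun i hi p q => ?_⟩, ⟨hab, ha, hb, fun i hi p q => ?_⟩, hk⟩
  · have ia : i ≠ a := by rintro rfl; exact h.rotate.not_swap p
    exact h2 i hi ((h.split i).2 (.inr (.inr p))) (by rwa [mul_swap_of_ne x ia p.ne.2.1.symm])
  · have id : i ≠ d := by rintro rfl; exact h.not_swap p
    rw [mul_swap_of_ne x p.ne.2.2.symm id] at q
    rcases (hk.split _).1 q with q | q | q
    · exact h1 i hi p q
    · exact p.ne.2.2.symm (x.injective q)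
    · exact h2 i hi ((h.split i).2 (.inl p)) (by rwa [mul_swap_of_ne x p.ne.2.1.symm p.ne.2.2.symm])

theorem exchange_left_outer_row (hdb : d ≠ b) (h1 : IsEmptyRect W x a b)
    (h2 : IsEmptyRect W (x * swap a b) d a) (h : Btw (x d) (x b) (x a)) :
    IsEmptyRect W x d a ∧ IsEmptyRect W (x * swap d a) d b ∧ Btw d b a := by
  simp only [isEmptyRect_iff] at *
  obtain ⟨hab, ha, hb, h1⟩ := h1
  obtain ⟨hda, hd, -, h2⟩ := h2
  have hb2 := h2 b hb
  rw [mul_swap_left, mul_swap_of_ne x hda hdb] at h2 hb2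
  rw [mul_swap_right] at hb2
  rw [mul_swap_left, mul_swap_of_ne x hdb.symm hab.symm]
  have hk : Btw d b a := (btw_or hdb hda hab.symm).resolve_right fun p => hb2 p h
  refine ⟨⟨hda, hd, ha, fun i hi p q => ?_⟩, ⟨hdb, hd, hb, fun i hi p q => ?_⟩, hk⟩
  · have ib : i ≠ b := by rintro rfl; exact hk.not_swap p
    exact h2 i hi p (by rw [mul_swap_of_ne x p.ne.2.2.symm ib]; exact (h.split _).2 (.inl q))
  · rcases (hk.split _).1 p with r | rfl | r
    · rw [mul_swap_of_ne x r.ne.2.1.symm r.ne.2.2.symm] at q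
      exact h2 i hi r (by
        rw [mul_swap_of_ne x r.ne.2.2.symm p.ne.2.2.symm]; exact (h.split _).2 (.inr (.inr q)))
    · rw [mul_swap_right] at q
      exact h.rotate.not_swap q
    · rw [mul_swap_of_ne x p.ne.2.1.symm r.ne.2.1.symm] at q
      exact h1 i hi r q

theorem exchange_right_inner (hda : d ≠ a) (h1 : IsEmptyRect W x a b)
    (h2 : IsEmptyRect W (x * swap a b) d b) (h : Btw a b d) :
    IsEmptyRect W x d b ∧ IsEmptyRect W (x * swap d b) a d ∧ Btw (x d) (x b) (x a) := by
  simp only [isEmptyRect_iff] at *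
  obtain ⟨hab, ha, hb, h1⟩ := h1
  obtain ⟨hdb, hd, -, h2⟩ := h2
  rw [mul_swap_right, mul_swap_of_ne x hda hdb] at h2
  rw [mul_swap_left, mul_swap_of_ne x hda.symm hab]
  have hk : Btw (x d) (x b) (x a) :=
    ((btw_or (x.injective.ne hab) (x.injective.ne hda.symm)
      (x.injective.ne hdb.symm)).resolve_left (h1 d hd h)).rotate.rotate
  refine ⟨⟨hdb, hd, hb, fun i hi p q => ?_⟩, ⟨hda.symm, ha, hd, fun i hi p q => ?_⟩, hk⟩
  · have ia : i ≠ a := by rintro rfl; exact h.rotate.not_swap p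
    rcases (hk.split _).1 q with q | q | q
    · exact h2 i hi p (by rwa [mul_swap_of_ne x ia p.ne.2.2.symm])
    · exact ia (x.injective q)
    · exact h1 i hi ((h.split i).2 (.inr (.inr p))) q
  · have ib : i ≠ b := by rintro rfl; exact h.not_swap p
    rw [mul_swap_of_ne x p.ne.2.2.symm ib] at q
    exact h1 i hi ((h.split i).2 (.inl p)) q

theorem exchange_left_inner_row (hdb : d ≠ b) (h1 : IsEmptyRect W x a b)
    (h2 : IsEmptyRect W (x * swap a b) d a) (h : Btw (x a) (x b) (x d)) :
    IsEmptyRect W x d b ∧ IsEmptyRect W (x * swap d b) a b ∧ Btw d b a := by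
  simp only [isEmptyRect_iff] at *
  obtain ⟨hab, ha, hb, h1⟩ := h1
  obtain ⟨hda, hd, -, h2⟩ := h2
  rw [mul_swap_left, mul_swap_of_ne x hda hdb] at h2
  rw [mul_swap_right, mul_swap_of_ne x hda.symm hab]
  have hk : Btw d b a :=
    ((btw_or hab hda.symm hdb.symm).resolve_left fun p => h1 d hd p h).rotate.rotate
  refine ⟨⟨hdb, hd, hb, fun i hi p q => ?_⟩, ⟨hab, ha, hb, fun i hi p q => ?_⟩, hk⟩
  · rcases (hk.split _).1 p with r | rfl | r
    · exact h2 i hi r (by rwa [mul_swap_of_ne x r.ne.2.2.symm p.ne.2.2.symm])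
    · exact h.rotate.not_swap q
    · exact h1 i hi r ((h.split _).2 (.inr (.inr q)))
  · have id : i ≠ d := by rintro rfl; exact hk.rotate.not_swap p
    rw [mul_swap_of_ne x id p.ne.2.2.symm] at q
    exact h1 i hi p ((h.split _).2 (.inl q))

theorem exchange_right_outer (hda : d ≠ a) (h1 : IsEmptyRect W x a b)
    (h2 : IsEmptyRect W (x * swap a b) d b) (h : Btw d b a) :
    IsEmptyRect W x d a ∧ IsEmptyRect W (x * swap d a) a b ∧ Btw (x d) (x b) (x a) := by
  simp only [isEmptyRect_iff] at *
  obtain ⟨hab, ha, hb, h1⟩ := h1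
  obtain ⟨hdb, hd, -, h2⟩ := h2
  have ha2 := h2 a ha h
  rw [mul_swap_right, mul_swap_of_ne x hda hdb] at h2 ha2
  rw [mul_swap_left] at ha2
  rw [mul_swap_right, mul_swap_of_ne x hdb.symm hab.symm]
  have hk : Btw (x d) (x b) (x a) := (btw_or (x.injective.ne hdb) (x.injective.ne hda)
    (x.injective.ne hab.symm)).resolve_right ha2
  refine ⟨⟨hda, hd, ha, fun i hi p q => ?_⟩, ⟨hab, ha, hb, fun i hi p q => ?_⟩, hk⟩
  · have ib : i ≠ b := by rintro rfl; exact h.not_swap p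
    exact h2 i hi ((h.split i).2 (.inl p)) (by rwa [mul_swap_of_ne x p.ne.2.2.symm ib])
  · have id : i ≠ d := by rintro rfl; exact h.rotate.not_swap p
    rw [mul_swap_of_ne x id p.ne.2.1.symm] at q
    rcases (hk.split _).1 q with q | q | q
    · exact h2 i hi ((h.split i).2 (.inr (.inr p)))
        (by rwa [mul_swap_of_ne x p.ne.2.1.symm p.ne.2.2.symm])
    · exact p.ne.2.1.symm (x.injective q)
    · exact h1 i hi p q

theorem exchange_right_outer_row (hda : d ≠ a) (h1 : IsEmptyRect W x a b)
    (h2 : IsEmptyRect W (x * swap a b) b d) (h : Btw (x a) (x d) (x b)) :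
    IsEmptyRect W x b d ∧ IsEmptyRect W (x * swap b d) a d ∧ Btw a d b := by
  simp only [isEmptyRect_iff] at *
  obtain ⟨hab, ha, hb, h1⟩ := h1
  obtain ⟨hbd, -, hd, h2⟩ := h2
  have ha2 := h2 a ha
  rw [mul_swap_right, mul_swap_of_ne x hda hbd.symm] at h2 ha2
  rw [mul_swap_left] at ha2
  rw [mul_swap_right, mul_swap_of_ne x hab hda.symm]
  have hk : Btw a d b :=
    ((btw_or hbd hab.symm hda).resolve_left fun p => ha2 p h).rotate.rotate
  refine ⟨⟨hbd, hb, hd, fun i hi p q => ?_⟩, ⟨hda.symm, ha, hd, fun i hi p q => ?_⟩, hk⟩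
  · have ia : i ≠ a := by rintro rfl; exact hk.rotate.not_swap p
    exact h2 i hi p (by rw [mul_swap_of_ne x ia p.ne.2.1.symm]; exact (h.split _).2 (.inr (.inr q)))
  · rcases (hk.split _).1 p with r | rfl | r
    · rw [mul_swap_of_ne x r.ne.2.2.symm p.ne.2.2.symm] at q
      exact h1 i hi r q
    · rw [mul_swap_left] at q
      exact h.not_swap q
    · rw [mul_swap_of_ne x r.ne.2.1.symm r.ne.2.2.symm] at q
      exact h2 i hi r (by
        rw [mul_swap_of_ne x p.ne.2.1.symm r.ne.2.1.symm]; exact (h.split _).2 (.inl q))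

end

end MarkedGrid

namespace MarkedGrid
open Equiv
variable {n : ℕ} [NeZero n]

theorem Btw.exit {a b c d : Fin n} (h : Btw a b c) (h' : ¬ Btw a b d) (ha : d ≠ a) (hb : d ≠ b) :
    Btw c d b ∧ Btw d c a := by
  simp only [btw_iff, Fin.lt_def, ne_eq, Fin.ext_iff] at *; omega

section
variable {W : Finset (Fin n)} {x : Perm (Fin n)} {a b c d : Fin n}

/-- Changing the order only affects emptiness through the corners that have moved. If one rectangle
contained a corner of the other in the new order but not in the old one, then by `Btw.exit` one of
its own corners would lie inside the other rectangle, or inside it in the other order, against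
emptiness. -/
theorem exchange_disjoint (hca : c ≠ a) (hcb : c ≠ b) (hda : d ≠ a) (hdb : d ≠ b)
    (h1 : IsEmptyRect W x a b) (h2 : IsEmptyRect W (x * swap a b) c d) :
    IsEmptyRect W x c d ∧ IsEmptyRect W (x * swap c d) a b := by
  simp only [isEmptyRect_iff] at *
  obtain ⟨hab, ha, hb, h1⟩ := h1
  obtain ⟨hcd, hc, hd, h2⟩ := h2
  have xne := fun {i j : Fin n} (h : i ≠ j) => x.injective.ne h
  rw [mul_swap_of_ne x hca hcb, mul_swap_of_ne x hda hdb] at h2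
  rw [mul_swap_of_ne x hca.symm hda.symm, mul_swap_of_ne x hcb.symm hdb.symm]
  have h2a := h2 a ha
  have h2b := h2 b hb
  rw [mul_swap_left] at h2a
  rw [mul_swap_right] at h2b
  refine ⟨⟨hcd, hc, hd, fun i hi p q => ?_⟩, ⟨hab, ha, hb, fun i hi p q => ?_⟩⟩
  · by_cases ia : i = a
    · subst ia
      exact h1 d hd (p.exit (fun h => h2b h q) hcb.symm hdb.symm).1
        (q.exit (h2a p) (xne hcb.symm) (xne hdb.symm)).1
    by_cases ib : i = b
    · subst ib
      exact h1 c hc (p.exit (fun h => h2a h q) hca.symm hda.symm).2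
        (q.exit (h2b p) (xne hca.symm) (xne hda.symm)).2
    exact h2 i hi p (by rwa [mul_swap_of_ne x ia ib])
  · by_cases ic : i = c
    · subst ic
      rw [mul_swap_left] at q
      exact h2b (p.exit (fun h => h1 d hd h q) hda hdb).1
        (q.exit (h1 i hi p) (xne hca) (xne hcb)).2
    by_cases id : i = d
    · subst id
      rw [mul_swap_right] at q
      exact h2a (p.exit (fun h => h1 c hc h q) hca hcb).2
        (q.exit (h1 i hi p) (xne hda) (xne hdb)).1
    rw [mul_swap_of_ne x ic id] at q
    exact h1 i hi p q

end

/-- Both sides are the indicator of the L-shape `P × Q` minus `P2 × Q2`, cut horizontally and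
vertically. -/
theorem ite_add_ite_of_disjoint {P P1 P2 Q Q1 Q2 R : Prop} [Decidable P] [Decidable P1]
    [Decidable P2] [Decidable Q] [Decidable Q1] [Decidable Q2] [Decidable R]
    (hP : P ↔ P1 ∨ P2) (hQ : Q ↔ Q1 ∨ Q2) (hP' : P1 → ¬ P2) (hQ' : Q1 → ¬ Q2) :
    ((if R ∧ P ∧ Q1 then 1 else 0) + (if R ∧ P1 ∧ Q2 then 1 else 0) : ℕ) =
      (if R ∧ P1 ∧ Q then 1 else 0) + (if R ∧ P2 ∧ Q1 then 1 else 0) := by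
  by_cases R <;> by_cases P1 <;> by_cases P2 <;> by_cases Q1 <;> by_cases Q2 <;> simp_all

section
variable (G : MarkedGrid n) (W : Finset (Fin n)) (x : Perm (Fin n)) {a b c d : Fin n}

theorem rectO_exchange_inner (hab : a ≠ b) (had : a ≠ d) (hdb : d ≠ b) (h : Btw a b d)
    (h' : Btw (x a) (x d) (x b)) :
    G.rectO W x (a, b) + G.rectO W (x * swap a b) (a, d) =
      G.rectO W x (a, d) + G.rectO W (x * swap a d) (d, b) := by
  funext i
  simp only [Pi.add_apply, rectO, mul_swap_left, mul_swap_right, mul_swap_of_ne x had.symm hdb,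
    mul_swap_of_ne x hab.symm hdb.symm]
  exact ite_add_ite_of_disjoint (h.inArc_split i) (h'.inArc_split _) (h.inArc_disj i)
    (h'.inArc_disj _)

theorem rectO_exchange_outer (hab : a ≠ b) (had : a ≠ d) (hdb : d ≠ b) (h : Btw a d b)
    (h' : Btw (x a) (x d) (x b)) :
    G.rectO W x (a, b) + G.rectO W (x * swap a b) (a, d) =
      G.rectO W x (b, d) + G.rectO W (x * swap b d) (a, b) := by
  funext i
  simp only [Pi.add_apply, rectO, mul_swap_left, mul_swap_of_ne x had.symm hdb,
    mul_swap_of_ne x hab had]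
  refine (add_comm _ _).trans (Eq.trans ?_ (add_comm _ _))
  exact ite_add_ite_of_disjoint (h.inArc_split i) ((h'.inArc_split _).trans or_comm)
    (h.inArc_disj i) (fun p q => h'.inArc_disj _ q p)

theorem rectO_exchange_inner_right (hab : a ≠ b) (had : a ≠ d) (hdb : d ≠ b) (h : Btw a b d)
    (h' : Btw (x d) (x b) (x a)) :
    G.rectO W x (a, b) + G.rectO W (x * swap a b) (d, b) =
      G.rectO W x (d, b) + G.rectO W (x * swap d b) (a, d) := by
  funext i
  simp only [Pi.add_apply, rectO, mul_swap_left, mul_swap_right, mul_swap_of_ne x had.symm hdb,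
    mul_swap_of_ne x had hab]
  exact ite_add_ite_of_disjoint ((h.inArc_split i).trans or_comm)
    ((h'.inArc_split _).trans or_comm) (fun p q => h.inArc_disj _ q p)
    (fun p q => h'.inArc_disj _ q p)

theorem rectO_exchange_outer_right (hab : a ≠ b) (had : a ≠ d) (hdb : d ≠ b) (h : Btw d b a)
    (h' : Btw (x d) (x b) (x a)) :
    G.rectO W x (a, b) + G.rectO W (x * swap a b) (d, b) =
      G.rectO W x (d, a) + G.rectO W (x * swap d a) (a, b) := by
  funext i
  simp only [Pi.add_apply, rectO, mul_swap_right, mul_swap_of_ne x had.symm hdb,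
    mul_swap_of_ne x hdb.symm hab.symm]
  refine (add_comm _ _).trans (Eq.trans ?_ (add_comm _ _))
  exact ite_add_ite_of_disjoint ((h.inArc_split i).trans or_comm) (h'.inArc_split _)
    (fun p q => h.inArc_disj _ q p) (h'.inArc_disj _)

theorem rectO_exchange_disjoint (hca : c ≠ a) (hcb : c ≠ b) (hda : d ≠ a) (hdb : d ≠ b) :
    G.rectO W x (a, b) + G.rectO W (x * swap a b) (c, d) =
      G.rectO W x (c, d) + G.rectO W (x * swap c d) (a, b) := by
  funext i
  simp only [Pi.add_apply, rectO, mul_swap_of_ne x hca hcb, mul_swap_of_ne x hda hdb,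
    mul_swap_of_ne x hca.symm hda.symm, mul_swap_of_ne x hcb.symm hdb.symm]
  rw [add_comm]

end

theorem swap_mul_swap_conj {n : ℕ} (a b c d : Fin n) :
    swap a b * swap c d = swap (swap a b c) (swap a b d) * swap a b :=
  Equiv.mul_swap_eq_swap_mul _ _ _

/-- A composition of two rectangles which is not an annulus. -/
structure IsChain (W : Finset (Fin n)) (x : Perm (Fin n)) (q : (Fin n × Fin n) × Fin n × Fin n) :
    Prop where
  left : IsEmptyRect W x q.1.1 q.1.2
  right : IsEmptyRect W (x * swap q.1.1 q.1.2) q.2.1 q.2.2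
  ne : ¬ (q.2.1 = q.1.1 ∧ q.2.2 = q.1.2)
  ne' : ¬ (q.2.1 = q.1.2 ∧ q.2.2 = q.1.1)

open Classical in
/-- The other decomposition of the domain of a composition of two rectangles. -/
noncomputable def exchange (x : Perm (Fin n)) :
    (Fin n × Fin n) × Fin n × Fin n → (Fin n × Fin n) × Fin n × Fin n
  | ((a, b), (c, d)) =>
    if c = a then if Btw a b d then ((a, d), (d, b)) else ((b, d), (a, b))
    else if d = b then if Btw a b c then ((c, b), (a, c)) else ((c, a), (a, b))
    else if d = a then if Btw (x a) (x b) (x c) then ((c, b), (a, b)) else ((c, a), (c, b))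
    else if c = b then if Btw (x a) (x b) (x d) then ((a, d), (a, b)) else ((b, d), (a, d))
    else ((c, d), (a, b))

/-- This collects what a cancellation in characteristic two needs: a fixed-point-free involution
that preserves the final matching and the powers of the variables. -/
theorem IsChain.exchange_spec (G : MarkedGrid n) {W : Finset (Fin n)} {x : Perm (Fin n)}
    {q : (Fin n × Fin n) × Fin n × Fin n} (h : IsChain W x q) :
    IsChain W x (exchange x q) ∧ exchange x (exchange x q) = q ∧ exchange x q ≠ q ∧
      swap (exchange x q).1.1 (exchange x q).1.2 * swap (exchange x q).2.1 (exchange x q).2.2 =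
        swap q.1.1 q.1.2 * swap q.2.1 q.2.2 ∧
      G.rectO W x (exchange x q).1 +
          G.rectO W (x * swap (exchange x q).1.1 (exchange x q).1.2) (exchange x q).2 =
        G.rectO W x q.1 + G.rectO W (x * swap q.1.1 q.1.2) q.2 := by
  obtain ⟨⟨a, b⟩, c, d⟩ := q
  obtain ⟨h1, h2, h3, h4⟩ := h
  dsimp only at h1 h2 h3 h4
  have hab := h1.1
  have hcd := h2.1
  have xne := fun {i j : Fin n} (h : i ≠ j) => x.injective.ne h
  by_cases hca : c = a
  · subst hca
    have hdb : d ≠ b := fun e => h3 ⟨rfl, e⟩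
    rcases btw_or hab hcd hdb.symm with h | h
    · obtain ⟨k1, k2, k3⟩ := exchange_left_inner hdb h1 h2 h
      have e : exchange x ((c, b), (c, d)) = ((c, d), (d, b)) := by
        simp [exchange, h]
      rw [e]
      refine ⟨⟨k1, k2, by simp [hcd.symm], by simp [hab.symm]⟩, ?_, by simp [hdb], ?_, ?_⟩
      · simp [exchange, k3, hcd.symm, hdb.symm, hab.symm]
      · dsimp only
        rw [swap_mul_swap_conj c d d b, swap_apply_right, swap_apply_of_ne_of_ne hab.symm hdb.symm]
      · exact (rectO_exchange_inner G W x hab hcd hdb h k3).symm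
    · obtain ⟨k1, k2, k3⟩ := exchange_left_outer hdb h1 h2 h
      have e : exchange x ((c, b), (c, d)) = ((b, d), (c, b)) := by
        simp [exchange, h.not_swap]
      rw [e]
      refine ⟨⟨k1, k2, by simp [hab], by simp [hcd]⟩, ?_, by simp [hab.symm], ?_, ?_⟩
      · simp [exchange, k3.rotate.not_swap, hdb.symm, hab]
      · dsimp only
        rw [swap_mul_swap_conj c b c d, swap_apply_left, swap_apply_of_ne_of_ne hcd.symm hdb]
      · exact (rectO_exchange_outer G W x hab hcd hdb h k3).symm
  by_cases hdb : d = b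
  · subst hdb
    rcases btw_or hab (Ne.symm hca) hcd.symm with h | h
    · obtain ⟨k1, k2, k3⟩ := exchange_right_inner hca h1 h2 h
      have e : exchange x ((a, d), (c, d)) = ((c, d), (a, c)) := by
        simp [exchange, h, hca]
      rw [e]
      refine ⟨⟨k1, k2, by simp [Ne.symm hca], by simp [hab]⟩, ?_, by simp [hca], ?_, ?_⟩
      · simp [exchange, k3, Ne.symm hca, hcd]
      · dsimp only
        rw [swap_mul_swap_conj c d a c, swap_apply_left, swap_apply_of_ne_of_ne (Ne.symm hca) hab]
      · exact (rectO_exchange_inner_right G W x hab (Ne.symm hca) hcd h k3).symm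
    · obtain ⟨k1, k2, k3⟩ := exchange_right_outer hca h1 h2 h.rotate.rotate
      have e : exchange x ((a, d), (c, d)) = ((c, a), (a, d)) := by
        simp [exchange, h.not_swap, hca]
      rw [e]
      refine ⟨⟨k1, k2, by simp [Ne.symm hca], by simp [hcd.symm]⟩, ?_, by simp [hca], ?_, ?_⟩
      · simp [exchange, k3.not_swap, Ne.symm hca, hcd.symm, hab.symm]
      · dsimp only
        rw [swap_mul_swap_conj a d c d, swap_apply_right, swap_apply_of_ne_of_ne hca hcd]
      · exact (rectO_exchange_outer_right G W x hab (Ne.symm hca) hcd h.rotate.rotate k3).symm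
  by_cases hda : d = a
  · subst hda
    have hcb : c ≠ b := fun e => h4 ⟨e, rfl⟩
    rcases btw_or (xne hab) (xne (Ne.symm hca)) (xne hcb.symm) with h | h
    · obtain ⟨k1, k2, k3⟩ := exchange_left_inner_row hcb h1 h2 h
      have e : exchange x ((d, b), (c, d)) = ((c, b), (d, b)) := by
        simp [exchange, h, hca, hdb]
      rw [e]
      refine ⟨⟨k1, k2, by simp [Ne.symm hca], by simp [hab]⟩, ?_, by simp [hca], ?_, ?_⟩
      · simp [exchange, k3, Ne.symm hca]
      · dsimp only
        rw [swap_mul_swap_conj d b c d, swap_apply_left, swap_apply_of_ne_of_ne hca hcb]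
      · exact rectO_exchange_inner_right G W x hcb hca hab k3 h
    · obtain ⟨k1, k2, k3⟩ := exchange_left_outer_row hcb h1 h2 h.rotate.rotate
      have e : exchange x ((d, b), (c, d)) = ((c, d), (c, b)) := by
        simp [exchange, h.not_swap, hca, hdb]
      rw [e]
      refine ⟨⟨k1, k2, by simp [hab.symm], by simp [hca]⟩, ?_, by simp [hca], ?_, ?_⟩
      · simp [exchange, k3.not_swap]
      · dsimp only
        rw [swap_mul_swap_conj c d c b, swap_apply_left,
          swap_apply_of_ne_of_ne hcb.symm hab.symm]
      · exact rectO_exchange_outer G W x hca hcb hab.symm k3 h.rotate.rotate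
  by_cases hcb : c = b
  · subst hcb
    rcases btw_or (xne hab) (xne (Ne.symm hda)) (xne hcd) with h | h
    · obtain ⟨k1, k2, k3⟩ := exchange_right_inner_row hda h1 h2 h
      have e : exchange x ((a, c), (c, d)) = ((a, d), (a, c)) := by
        simp [exchange, h, hca, hdb, hda]
      rw [e]
      refine ⟨⟨k1, k2, by simp [hcd], by simp [Ne.symm hda]⟩, ?_, by simp [hdb], ?_, ?_⟩
      · simp [exchange, k3]
      · dsimp only
        rw [swap_mul_swap_conj a c c d, swap_apply_right, swap_apply_of_ne_of_ne hda hdb]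
      · exact rectO_exchange_inner G W x (Ne.symm hda) hab hcd k3 h
    · obtain ⟨k1, k2, k3⟩ := exchange_right_outer_row hda h1 h2 h
      have e : exchange x ((a, c), (c, d)) = ((c, d), (a, d)) := by
        simp [exchange, h.not_swap, hca, hdb, hda]
      rw [e]
      refine ⟨⟨k1, k2, by simp [hab], by simp [Ne.symm hda]⟩, ?_, by simp [hca], ?_, ?_⟩
      · simp [exchange, k3.rotate.not_swap, hab]
      · dsimp only
        rw [swap_mul_swap_conj c d a d, swap_apply_right,
          swap_apply_of_ne_of_ne hab (Ne.symm hda)]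
      · exact rectO_exchange_outer_right G W x hcd hca (Ne.symm hda) k3 h
  · obtain ⟨k1, k2⟩ := exchange_disjoint hca hcb hda hdb h1 h2
    have e : exchange x ((a, b), (c, d)) = ((c, d), (a, b)) := by
      simp [exchange, hca, hcb, hda, hdb]
    rw [e]
    refine ⟨⟨k1, k2, by simp [Ne.symm hca], by simp [Ne.symm hda]⟩, ?_, by simp [hca], ?_, ?_⟩
    · simp [exchange, Ne.symm hca, Ne.symm hcb, Ne.symm hda, Ne.symm hdb]
    · dsimp only
      rw [swap_mul_swap_conj c d a b, swap_apply_of_ne_of_ne (Ne.symm hca) (Ne.symm hda),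
        swap_apply_of_ne_of_ne (Ne.symm hcb) (Ne.symm hdb)]
    · exact (rectO_exchange_disjoint G W x hca hcb hda hdb).symm

open Classical in
theorem sum_isChain_eq_zero {M : Type*} [AddCommGroup M] (hM : ∀ m : M, m + m = 0)
    (G : MarkedGrid n) (W : Finset (Fin n)) (x z : Perm (Fin n)) (F : (Fin n → ℕ) → M) :
    ∑ q : (Fin n × Fin n) × Fin n × Fin n with
      IsChain W x q ∧ x * swap q.1.1 q.1.2 * swap q.2.1 q.2.2 = z,
      F (G.rectO W x q.1 + G.rectO W (x * swap q.1.1 q.1.2) q.2) = 0 := by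
  refine Finset.sum_involution (fun q _ => exchange x q) ?_ ?_ ?_ ?_
  · intro q hq
    rw [Finset.mem_filter] at hq
    obtain ⟨-, -, -, -, e⟩ := hq.2.1.exchange_spec G
    rw [e, hM]
  · intro q hq _
    rw [Finset.mem_filter] at hq
    exact (hq.2.1.exchange_spec G).2.2.1
  · intro q hq
    rw [Finset.mem_filter] at hq ⊢
    obtain ⟨h1, -, -, h2, -⟩ := hq.2.1.exchange_spec G
    refine ⟨Finset.mem_univ _, h1, ?_⟩
    rw [mul_assoc, h2, ← mul_assoc, hq.2.2]
  · intro q hq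
    rw [Finset.mem_filter] at hq
    exact (hq.2.1.exchange_spec G).2.1

end MarkedGrid

/-! ### Annuli, and the square of the rectangle count -/

namespace MarkedGrid
open Equiv
variable {n : ℕ} [NeZero n]

theorem InArc.not_swap {a b : Fin n} (h : a ≠ b) (i : Fin n) : InArc a b i ↔ ¬ InArc b a i := by
  simp only [inArc_iff, Fin.lt_def, Fin.le_def, ne_eq, Fin.ext_iff] at *; omega

theorem inArc_left {a b : Fin n} (h : a ≠ b) : InArc a b a := by
  simp only [inArc_iff, Fin.lt_def, Fin.le_def, ne_eq, Fin.ext_iff] at *; omega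

theorem Btw.inArc {a b c : Fin n} (h : Btw a b c) : InArc a b c := h.2

theorem InArc.eq_or_btw {a b c : Fin n} (h : InArc a b c) : c = a ∨ Btw a b c := by
  by_cases e : c = a
  · exact .inl e
  · exact .inr ⟨e, h⟩

theorem exists_adjacent {W : Finset (Fin n)} (x : Perm (Fin n)) {a b : Fin n} (hb : b ∉ W)
    (hba : b ≠ a) : ∃ c, c ∉ W ∧ c ≠ a ∧ ∀ i, i ∉ W → ¬ Btw (x a) (x c) (x i) := by
  classical
  obtain ⟨c, hc, h⟩ := Finset.exists_min_image (Finset.univ.filter fun c => c ∉ W ∧ c ≠ a)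
    (fun c => x c - x a) ⟨b, by simp [hb, hba]⟩
  simp only [Finset.mem_filter, Finset.mem_univ, true_and] at hc h
  exact ⟨c, hc.1, hc.2, fun i hi p => (h i ⟨hi, fun e => p.1 (by rw [e])⟩).not_gt p.2⟩

theorem adjacent_unique {W : Finset (Fin n)} {x : Perm (Fin n)} {a b c : Fin n} (hb : b ∉ W)
    (hba : b ≠ a) (hb' : ∀ i, i ∉ W → ¬ Btw (x a) (x b) (x i)) (hc : c ∉ W) (hca : c ≠ a)
    (hc' : ∀ i, i ∉ W → ¬ Btw (x a) (x c) (x i)) : b = c := by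
  by_contra h
  exact (btw_or (x.injective.ne hba.symm) (x.injective.ne hca.symm) (x.injective.ne h)).elim
    (hb' c hc) (hc' b hb)

section
variable {W : Finset (Fin n)} {x : Perm (Fin n)} {a b : Fin n}

/-- The two rectangles are stacked in one strip of columns and their row arcs are complementary. A
point on a circle inside the strip would be interior to one of them, so an annulus has no unremoved
circle inside. -/
theorem isEmptyRect_vertical_iff :
    (IsEmptyRect W x a b ∧ IsEmptyRect W (x * swap a b) a b) ↔
      a ≠ b ∧ a ∉ W ∧ b ∉ W ∧ ∀ i, i ∉ W → ¬ Btw a b i := by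
  simp only [isEmptyRect_iff, mul_swap_left, mul_swap_right]
  constructor
  · rintro ⟨⟨hab, ha, hb, h1⟩, -, -, -, h2⟩
    refine ⟨hab, ha, hb, fun i hi p => ?_⟩
    have h2 := h2 i hi p
    rw [mul_swap_of_ne x p.ne.2.1.symm p.ne.2.2.symm] at h2
    rcases btw_or (x.injective.ne hab) (x.injective.ne p.ne.2.1) (x.injective.ne p.ne.2.2) with q | q
    · exact h1 i hi p q
    · exact h2 q.rotate.rotate.rotate.rotate
  · rintro ⟨hab, ha, hb, h⟩
    exact ⟨⟨hab, ha, hb, fun i hi p => (h i hi p).elim⟩, hab, ha, hb,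
      fun i hi p => (h i hi p).elim⟩

theorem isEmptyRect_horizontal_iff :
    (IsEmptyRect W x a b ∧ IsEmptyRect W (x * swap a b) b a) ↔
      a ≠ b ∧ a ∉ W ∧ b ∉ W ∧ ∀ i, i ∉ W → ¬ Btw (x a) (x b) (x i) := by
  simp only [isEmptyRect_iff, mul_swap_left, mul_swap_right]
  constructor
  · rintro ⟨⟨hab, ha, hb, h1⟩, -, -, -, h2⟩
    refine ⟨hab, ha, hb, fun i hi q => ?_⟩
    have ia : i ≠ a := by rintro rfl; exact q.ne.2.1 rfl
    have ib : i ≠ b := by rintro rfl; exact q.ne.2.2 rfl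
    have h2 := h2 i hi
    rw [mul_swap_of_ne x ia ib] at h2
    rcases btw_total hab ia.symm ib.symm with p | p
    · exact h1 i hi p q
    · exact h2 p q
  · rintro ⟨hab, ha, hb, h⟩
    refine ⟨⟨hab, ha, hb, fun i hi _ => h i hi⟩, hab.symm, hb, ha, fun i hi p => ?_⟩
    rw [mul_swap_of_ne x p.ne.2.2.symm p.ne.2.1.symm]
    exact h i hi

theorem rectO_vertical (G : MarkedGrid n) (hab : a ≠ b) (ha : a ∉ W)
    (h : ∀ i, i ∉ W → ¬ Btw a b i) :
    G.rectO W x (a, b) + G.rectO W (x * swap a b) (a, b) = Pi.single a 1 := by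
  funext i
  simp only [Pi.add_apply, rectO, mul_swap_left, mul_swap_right]
  by_cases hi : i = a
  · subst hi
    have h1 := InArc.not_swap (x.injective.ne hab) (G.O i)
    simp only [Pi.single_eq_same, ha, not_false_eq_true, inArc_left hab, true_and, h1]
    split_ifs <;> simp_all
  · rw [Pi.single_eq_of_ne hi, if_neg fun p => h i p.1 ⟨hi, p.2.1⟩,
      if_neg fun p => h i p.1 ⟨hi, p.2.1⟩, add_zero]

/-- Every row of the annulus other than that of `x a` starts at a removed horizontal circle, and by
`hx` its `O` belongs to `W` and is not counted. The `O` in the row of `x a` is not in `W` because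
`a` is not, and exactly one of the two complementary column arcs contains it. -/
theorem rectO_horizontal (G : MarkedGrid n) (hx : ∀ c ∈ W, x c = G.O c) (hab : a ≠ b) (ha : a ∉ W)
    (h : ∀ i, i ∉ W → ¬ Btw (x a) (x b) (x i)) :
    G.rectO W x (a, b) + G.rectO W (x * swap a b) (b, a) = Pi.single (G.O.symm (x a)) 1 := by
  funext i
  simp only [Pi.add_apply, rectO, mul_swap_left, mul_swap_right]
  by_cases hi : i = G.O.symm (x a)
  · subst hi
    have hW : G.O.symm (x a) ∉ W := fun hW => ha (by
      have := hx _ hW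
      rw [apply_symm_apply] at this
      rwa [x.injective this] at hW)
    have h1 := InArc.not_swap hab (G.O.symm (x a))
    simp only [Pi.single_eq_same, hW, not_false_eq_true, apply_symm_apply,
      inArc_left (x.injective.ne hab), true_and, and_true, h1]
    split_ifs <;> simp_all
  · have key : i ∉ W → ¬ InArc (x a) (x b) (G.O i) := by
      intro hW p
      rcases p.eq_or_btw with p | p
      · exact hi (by rw [← p, symm_apply_apply])
      · refine h (x.symm (G.O i)) (fun h' => hW ?_) (by rwa [apply_symm_apply])
        have := hx _ h'
        rw [apply_symm_apply] at this
        rwa [← G.O.injective this] at h'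
    rw [Pi.single_eq_of_ne hi, if_neg fun p => key p.1 p.2.2, if_neg fun p => key p.1 p.2.2,
      add_zero]

end

-- Each unremoved circle has a unique unremoved successor, provided that there is another one. When
-- only one circle is left there are no rectangles, hence no annuli, which is why the existence of
-- `b` stays in the index set.
open Classical in
theorem sum_adjacent {M : Type*} [AddCommMonoid M] (W : Finset (Fin n)) (x : Perm (Fin n))
    (F : Fin n → M) :
    ∑ r : Fin n × Fin n with
        r.1 ≠ r.2 ∧ r.1 ∉ W ∧ r.2 ∉ W ∧ ∀ i, i ∉ W → ¬ Btw (x r.1) (x r.2) (x i), F r.1 =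
      ∑ a with a ∉ W ∧ ∃ b, b ∉ W ∧ b ≠ a, F a := by
  refine Finset.sum_nbij Prod.fst ?_ ?_ ?_ (fun _ _ => rfl)
  · rintro ⟨a, b⟩ h
    simp only [Finset.mem_filter, Finset.mem_univ, true_and] at h ⊢
    exact ⟨h.2.1, b, h.2.2.1, h.1.symm⟩
  · rintro ⟨a, b⟩ h ⟨a', b'⟩ h' (rfl : a = a')
    rw [SetLike.mem_coe, Finset.mem_filter] at h h'
    exact Prod.ext rfl
      (adjacent_unique h.2.2.2.1 h.2.1.symm h.2.2.2.2 h'.2.2.2.1 h'.2.1.symm h'.2.2.2.2)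
  · intro a h
    rw [SetLike.mem_coe, Finset.mem_filter] at h
    obtain ⟨-, ha, b, hb, hba⟩ := h
    obtain ⟨c, hc, hca, h⟩ := exists_adjacent x hb hba
    exact ⟨(a, c), by simpa using ⟨hca.symm, ha, hc, h⟩, rfl⟩

open Classical in
theorem sum_emptyRect {M : Type*} [AddCommMonoid M] (W : Finset (Fin n)) (x : Perm (Fin n))
    (g : Perm (Fin n) → Fin n × Fin n → M) :
    ∑ y, ∑ r ∈ emptyRect W x y, g y r =
      ∑ r with IsEmptyRect W x r.1 r.2, g (x * swap r.1 r.2) r := by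
  have h : ∀ y, ∑ r ∈ emptyRect W x y, g y r = ∑ r with IsEmptyRect W x r.1 r.2,
      if y = x * swap r.1 r.2 then g y r else 0 := by
    intro y
    rw [← Finset.sum_filter, Finset.filter_filter]
    exact Finset.sum_congr (by ext r; simp [mem_emptyRect]) fun _ _ => rfl
  simp only [h]
  rw [Finset.sum_comm]
  simp

open Classical in
/-- Two consecutive rectangles contribute zero to the square of the differential: those which do
not form an annulus come in pairs with the same domain, and the contributions of the vertical
annuli and of the horizontal annuli agree. -/
theorem sum_emptyRect_emptyRect {M : Type*} [AddCommGroup M] (hM : ∀ m : M, m + m = 0)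
    (G : MarkedGrid n) {W : Finset (Fin n)} {x : Perm (Fin n)} (hx : ∀ c ∈ W, x c = G.O c)
    (z : Perm (Fin n)) (F : (Fin n → ℕ) → M) :
    ∑ y, ∑ r ∈ emptyRect W x y, ∑ r' ∈ emptyRect W y z, F (G.rectO W x r + G.rectO W y r') = 0 := by
  rw [sum_emptyRect W x fun y r => ∑ r' ∈ emptyRect W y z, F (G.rectO W x r + G.rectO W y r')]
  have h1 : ∑ r : Fin n × Fin n with IsEmptyRect W x r.1 r.2,
      ∑ r' ∈ emptyRect W (x * swap r.1 r.2) z,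
        F (G.rectO W x r + G.rectO W (x * swap r.1 r.2) r') =
      ∑ q : (Fin n × Fin n) × Fin n × Fin n with
        (IsEmptyRect W x q.1.1 q.1.2 ∧ IsEmptyRect W (x * swap q.1.1 q.1.2) q.2.1 q.2.2) ∧
          x * swap q.1.1 q.1.2 * swap q.2.1 q.2.2 = z,
        F (G.rectO W x q.1 + G.rectO W (x * swap q.1.1 q.1.2) q.2) := by
    rw [Finset.sum_filter, Finset.sum_filter]
    refine Eq.trans ?_ (Fintype.sum_prod_type _).symm
    refine Finset.sum_congr rfl fun r _ => ?_
    split_ifs with h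
    · rw [← Finset.sum_filter]
      refine Finset.sum_congr ?_ fun _ _ => rfl
      ext r'
      simp [mem_emptyRect, h, eq_comm]
    · simp [h]
  rw [h1, ← Finset.sum_filter_add_sum_filter_not _ (fun q => IsChain W x q), Finset.filter_filter,
    Finset.filter_filter]
  have h2 := sum_isChain_eq_zero hM G W x z F
  rw [Finset.sum_congr (s₂ := Finset.univ.filter fun q : (Fin n × Fin n) × Fin n × Fin n =>
    IsChain W x q ∧ x * swap q.1.1 q.1.2 * swap q.2.1 q.2.2 = z) ?_ fun _ _ => rfl, h2, zero_add]
  swap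
  · ext q
    simp only [Finset.mem_filter, Finset.mem_univ, true_and]
    exact ⟨fun h => ⟨h.2, h.1.2⟩, fun h => ⟨⟨⟨h.1.left, h.1.right⟩, h.2⟩, h.1⟩⟩
  by_cases hz : z = x
  swap
  · refine Finset.sum_eq_zero fun q hq => (hz ?_).elim
    simp only [Finset.mem_filter, Finset.mem_univ, true_and] at hq
    obtain ⟨⟨⟨k1, k2⟩, rfl⟩, k3⟩ := hq
    have : (q.2.1 = q.1.1 ∧ q.2.2 = q.1.2) ∨ (q.2.1 = q.1.2 ∧ q.2.2 = q.1.1) := by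
      by_contra h
      rw [not_or] at h
      exact k3 ⟨k1, k2, h.1, h.2⟩
    rcases this with ⟨e1, e2⟩ | ⟨e1, e2⟩ <;> rw [e1, e2]
    · rw [mul_assoc, swap_mul_self, mul_one]
    · rw [swap_comm q.1.2, mul_assoc, swap_mul_self, mul_one]
  subst hz
  have h3 : (Finset.univ.filter fun q : (Fin n × Fin n) × Fin n × Fin n =>
      ((IsEmptyRect W z q.1.1 q.1.2 ∧ IsEmptyRect W (z * swap q.1.1 q.1.2) q.2.1 q.2.2) ∧
          z * swap q.1.1 q.1.2 * swap q.2.1 q.2.2 = z) ∧ ¬ IsChain W z q) =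
      (Finset.univ.filter fun r : Fin n × Fin n => r.1 ≠ r.2 ∧ r.1 ∉ W ∧ r.2 ∉ W ∧
          ∀ i, i ∉ W → ¬ Btw r.1 r.2 i).image (fun r => (r, r)) ∪
        (Finset.univ.filter fun r : Fin n × Fin n => r.1 ≠ r.2 ∧ r.1 ∉ W ∧ r.2 ∉ W ∧
          ∀ i, i ∉ W → ¬ Btw (z r.1) (z r.2) (z i)).image (fun r => (r, r.swap)) := by
    ext q
    simp only [Finset.mem_union, Finset.mem_image, Finset.mem_filter, Finset.mem_univ, true_and]
    constructor
    · obtain ⟨⟨a, b⟩, c, d⟩ := q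
      rintro ⟨⟨⟨k1, k2⟩, -⟩, k3⟩
      have : (c = a ∧ d = b) ∨ (c = b ∧ d = a) := by
        by_contra h
        rw [not_or] at h
        exact k3 ⟨k1, k2, h.1, h.2⟩
      rcases this with ⟨rfl, rfl⟩ | ⟨rfl, rfl⟩
      · exact .inl ⟨(c, d), isEmptyRect_vertical_iff.1 ⟨k1, k2⟩, rfl⟩
      · exact .inr ⟨(d, c), isEmptyRect_horizontal_iff.1 ⟨k1, k2⟩, rfl⟩
    · rintro (⟨⟨a, b⟩, h, rfl⟩ | ⟨⟨a, b⟩, h, rfl⟩)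
      · refine ⟨⟨isEmptyRect_vertical_iff.2 h, ?_⟩, fun k => k.ne ⟨rfl, rfl⟩⟩
        rw [mul_assoc, swap_mul_self, mul_one]
      · refine ⟨⟨isEmptyRect_horizontal_iff.2 h, ?_⟩, fun k => k.ne' ⟨rfl, rfl⟩⟩
        rw [Prod.swap, swap_comm (a, b).2, mul_assoc, swap_mul_self, mul_one]
  rw [h3, Finset.sum_union, Finset.sum_image fun r _ r' _ h => (Prod.ext_iff.1 h).1,
    Finset.sum_image fun r _ r' _ h => (Prod.ext_iff.1 h).1]
  -- Vertical annuli are adjacencies for the identity permutation.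
  · have h4 : ∑ r : Fin n × Fin n with
          r.1 ≠ r.2 ∧ r.1 ∉ W ∧ r.2 ∉ W ∧ ∀ i, i ∉ W → ¬ Btw r.1 r.2 i, F (Pi.single r.1 1) =
        ∑ a with a ∉ W ∧ ∃ b, b ∉ W ∧ b ≠ a, F (Pi.single a 1) :=
      sum_adjacent W 1 fun a => F (Pi.single a 1)
    rw [Finset.sum_congr rfl (g := fun r => F (Pi.single r.1 1)),
      Finset.sum_congr (s₁ := Finset.univ.filter fun r : Fin n × Fin n => r.1 ≠ r.2 ∧ r.1 ∉ W ∧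
        r.2 ∉ W ∧ ∀ i, i ∉ W → ¬ Btw (z r.1) (z r.2) (z i)) rfl
        (g := fun r => F (Pi.single (G.O.symm (z r.1)) 1)),
      h4, sum_adjacent W z fun a => F (Pi.single (G.O.symm (z a)) 1)]
    -- Sending a circle to the column of the `O` in the row of its point permutes the unremoved
    -- indices. The two kinds of annuli thus give the same sum, and twice it is zero.
    · rw [Finset.sum_equiv (t := Finset.univ.filter fun a => a ∉ W ∧ ∃ b, b ∉ W ∧ b ≠ a)
        (f := fun a => F (Pi.single (G.O.symm (z a)) 1))
        (g := fun a => F (Pi.single a 1)) (z.trans G.O.symm) ?_ (fun _ _ => rfl), hM]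
      have key : ∀ a, G.O.symm (z a) ∈ W ↔ a ∈ W := fun a => by
        constructor
        · intro h
          have := hx _ h
          rw [apply_symm_apply] at this
          rwa [z.injective this] at h
        · intro h
          rwa [hx a h, symm_apply_apply]
      intro a
      simp only [Finset.mem_filter, Finset.mem_univ, true_and, trans_apply, key]
      refine and_congr_right fun _ => ?_
      constructor
      · rintro ⟨b, hb, hba⟩
        exact ⟨G.O.symm (z b), (key b).not.2 hb,
          fun e => hba (z.injective (G.O.symm.injective e))⟩
      · rintro ⟨b, hb, hba⟩
        refine ⟨z.symm (G.O b), fun h => hb ?_, fun e => hba ?_⟩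
        · rwa [← key, apply_symm_apply, symm_apply_apply] at h
        · rw [← e, apply_symm_apply, symm_apply_apply]
    · rintro ⟨a, b⟩ h
      rw [Finset.mem_filter] at h
      exact congrArg F (rectO_horizontal G hx h.2.1 h.2.2.1 h.2.2.2.2)
    · rintro ⟨a, b⟩ h
      rw [Finset.mem_filter] at h
      exact congrArg F (rectO_vertical G h.2.1 h.2.2.1 h.2.2.2.2)
  · rw [Finset.disjoint_left]
    rintro q h h'
    rw [Finset.mem_image] at h h'
    obtain ⟨r, h, rfl⟩ := h
    obtain ⟨r', -, e⟩ := h'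
    obtain ⟨rfl, e⟩ := Prod.ext_iff.1 e
    rw [Finset.mem_filter] at h
    exact h.2.1 (Prod.ext_iff.1 e).2

end MarkedGrid

/-! ### The differential squares to zero -/

namespace MarkedGrid
open Equiv

theorem Pair.finsupp_add_self {n : ℕ} {G : MarkedGrid n} (m : G.Pair →₀ ZMod 2) : m + m = 0 := by
  ext p
  exact CharTwo.add_self_eq_zero _

variable {n : ℕ} [NeZero n]

/-- Pre-composition with rectangles. -/
noncomputable def preDiff (G : MarkedGrid n) (p : G.Pair) : G.Pair →₀ ZMod 2 :=
  ∑ x' : Perm (Fin n), ∑ r ∈ emptyRect ∅ x' p.x,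
    Finsupp.single (⟨x', p.y, p.ε, p.N + G.rectO ∅ x' r⟩ : G.Pair) 1

/-- Post-composition with rectangles. -/
noncomputable def postDiff (G : MarkedGrid n) (p : G.Pair) : G.Pair →₀ ZMod 2 :=
  ∑ y' : G.DestabState, ∑ r ∈ emptyRect G.Z p.y.1 y'.1,
    Finsupp.single (⟨p.x, y', p.ε, p.N + G.rectO G.Z p.y.1 r⟩ : G.Pair) 1

/-- The contribution of the mapping cone of `U_c - U_{c'}`. -/
noncomputable def coneDiff (G : MarkedGrid n) (c : G.Z) (p : G.Pair) : G.Pair →₀ ZMod 2 :=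
  if p.ε c = false then
    Finsupp.single (⟨p.x, p.y, Function.update p.ε c true, p.N + Pi.single (c : Fin n) 1⟩ : G.Pair) 1
      - Finsupp.single (⟨p.x, p.y, Function.update p.ε c true,
        p.N + Pi.single (G.O.symm (G.O c - 1)) 1⟩ : G.Pair) 1
  else 0

theorem diffPair_eq (G : MarkedGrid n) (p : G.Pair) :
    G.diffPair p = G.preDiff p + G.postDiff p + ∑ c : G.Z, G.coneDiff c p := rfl

/-- Linear extension. -/
noncomputable def linExt {n : ℕ} (G : MarkedGrid n) (g : G.Pair → G.Pair →₀ ZMod 2) :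
    (G.Pair →₀ ZMod 2) →ₗ[ZMod 2] (G.Pair →₀ ZMod 2) :=
  Finsupp.linearCombination (ZMod 2) g

theorem linExt_single {n : ℕ} {G : MarkedGrid n} (g : G.Pair → G.Pair →₀ ZMod 2) (p : G.Pair) :
    G.linExt g (Finsupp.single p 1) = g p := by
  simp [linExt]

theorem pre_pre (G : MarkedGrid n) (p : G.Pair) : G.linExt G.preDiff (G.preDiff p) = 0 := by
  conv_lhs => rw [preDiff]
  simp only [map_sum, linExt_single]
  simp only [preDiff, add_assoc]
  refine (Finset.sum_congr rfl fun x' _ => (Finset.sum_comm.trans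
    (Finset.sum_congr rfl fun x'' _ => Finset.sum_comm))).trans ?_
  rw [Finset.sum_comm]
  refine Finset.sum_eq_zero fun x'' _ => ?_
  have h := sum_emptyRect_emptyRect Pair.finsupp_add_self G (W := ∅) (x := x'') (by simp) p.x
    fun N => Finsupp.single (⟨x'', p.y, p.ε, p.N + N⟩ : G.Pair) (1 : ZMod 2)
  rw [← h]
  refine Finset.sum_congr rfl fun _ _ => Finset.sum_congr rfl fun _ _ =>
    Finset.sum_congr rfl fun _ _ => ?_
  rw [add_comm (G.rectO ∅ _ _)]

theorem mem_emptyRect_destab {G : MarkedGrid n} (y : G.DestabState) {y' : Perm (Fin n)}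
    {r : Fin n × Fin n} (h : r ∈ emptyRect G.Z y.1 y') : ∀ c ∈ G.Z, y' c = G.O c := by
  rw [mem_emptyRect] at h
  intro c hc
  rw [h.2, mul_swap_of_ne, y.2 c hc]
  · rintro rfl; exact h.1.2.1 hc
  · rintro rfl; exact h.1.2.2.1 hc

theorem post_post (G : MarkedGrid n) (p : G.Pair) : G.linExt G.postDiff (G.postDiff p) = 0 := by
  conv_lhs => rw [postDiff]
  simp only [map_sum, linExt_single]
  simp only [postDiff, add_assoc]
  refine (Finset.sum_congr rfl fun y' _ => Finset.sum_comm).trans ?_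
  rw [Finset.sum_comm]
  refine Finset.sum_eq_zero fun y'' _ => ?_
  have h3 := sum_emptyRect_emptyRect Pair.finsupp_add_self G p.y.2 y''.1
    fun N => Finsupp.single (⟨p.x, y'', p.ε, p.N + N⟩ : G.Pair) (1 : ZMod 2)
  classical
  -- The rectangle identity runs over all intermediate matchings; those reached from `p.y`
  -- automatically contain the destabilization points.
  rw [← Finset.sum_subset (Finset.subset_univ
      (Finset.univ.filter fun y : Perm (Fin n) => ∀ c ∈ G.Z, y c = G.O c)),
    Finset.sum_subtype (p := fun y : Perm (Fin n) => ∀ c ∈ G.Z, y c = G.O c)] at h3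
  · exact h3
  · simp
  · intro y _ hy
    refine Finset.sum_eq_zero fun r hr => (hy ?_).elim
    simpa using mem_emptyRect_destab p.y hr

theorem pre_post (G : MarkedGrid n) (p : G.Pair) :
    G.linExt G.preDiff (G.postDiff p) = G.linExt G.postDiff (G.preDiff p) := by
  conv_lhs => rw [postDiff]
  conv_rhs => rw [preDiff]
  simp only [map_sum, linExt_single]
  simp only [postDiff, preDiff]
  refine (Finset.sum_congr rfl fun y' _ => (Finset.sum_comm.trans
    (Finset.sum_congr rfl fun x' _ => Finset.sum_comm))).trans ?_
  rw [Finset.sum_comm]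
  refine Finset.sum_congr rfl fun x' _ => ?_
  rw [Finset.sum_comm]
  simp only [add_right_comm]

theorem pre_cone (G : MarkedGrid n) (p : G.Pair) (c : G.Z) :
    G.linExt G.preDiff (G.coneDiff c p) = G.linExt (G.coneDiff c) (G.preDiff p) := by
  rw [preDiff]
  simp only [map_sum, linExt_single]
  by_cases h : p.ε c = false
  · simp only [coneDiff, h, if_true, map_sub, linExt_single, preDiff, ← Finset.sum_sub_distrib]
    simp only [add_right_comm]
  · simp [coneDiff, h]

theorem post_cone (G : MarkedGrid n) (p : G.Pair) (c : G.Z) :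
    G.linExt G.postDiff (G.coneDiff c p) = G.linExt (G.coneDiff c) (G.postDiff p) := by
  rw [postDiff]
  simp only [map_sum, linExt_single]
  by_cases h : p.ε c = false
  · simp only [coneDiff, h, if_true, map_sub, linExt_single, postDiff, ← Finset.sum_sub_distrib]
    simp only [add_right_comm]
  · simp [coneDiff, h]

theorem cone_cone_self (G : MarkedGrid n) (p : G.Pair) (c : G.Z) :
    G.linExt (G.coneDiff c) (G.coneDiff c p) = 0 := by
  by_cases h : p.ε c = false
  · simp [coneDiff, h, linExt_single]
  · simp [coneDiff, h]

theorem cone_cone (G : MarkedGrid n) (p : G.Pair) {c c' : G.Z} (hc : c ≠ c') :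
    G.linExt (G.coneDiff c) (G.coneDiff c' p) = G.linExt (G.coneDiff c') (G.coneDiff c p) := by
  by_cases h : p.ε c = false <;> by_cases h' : p.ε c' = false
  · simp only [coneDiff, h, h', if_true, map_sub, linExt_single, Function.update_of_ne hc,
      Function.update_of_ne hc.symm, Function.update_comm hc]
    simp only [add_right_comm _ (Pi.single (c' : Fin n) 1 : Fin n → ℕ),
      add_right_comm _ (Pi.single (G.O.symm (G.O c' - 1)) 1 : Fin n → ℕ)]
    abel
  · simp [coneDiff, h, h', linExt_single, Function.update_of_ne hc.symm]
  · simp [coneDiff, h, h', linExt_single, Function.update_of_ne hc]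
  · simp [coneDiff, h, h']

theorem diff_diff (G : MarkedGrid n) : G.diff ∘ₗ G.diff = 0 := by
  have hd : ∀ f, G.diff f =
      G.linExt G.preDiff f + G.linExt G.postDiff f + ∑ c, G.linExt (G.coneDiff c) f := by
    have : G.diff = G.linExt G.preDiff + G.linExt G.postDiff + ∑ c, G.linExt (G.coneDiff c) := by
      refine Finsupp.lhom_ext' fun p => LinearMap.ext_ring ?_
      simp [diff, linExt, diffPair_eq]
    intro f
    rw [this]
    simp
  refine Finsupp.lhom_ext' fun p => LinearMap.ext_ring ?_
  have h0 : G.diff (Finsupp.single p 1) = G.diffPair p := by simp [diff]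
  simp only [LinearMap.comp_apply, Finsupp.lsingle_apply, LinearMap.zero_apply, h0]
  -- Terms with distinct points cancel in symmetric pairs. The diagonal terms vanish since a marking
  -- changes from left to right only once.
  have hcc : ∑ c, ∑ c', G.linExt (G.coneDiff c) (G.coneDiff c' p) = 0 := by
    rw [← Fintype.sum_prod_type']
    refine Finset.sum_involution (fun q _ => q.swap) ?_ ?_ (fun _ _ => Finset.mem_univ _)
      (fun _ _ => rfl)
    · rintro ⟨c, c'⟩ -
      by_cases hc : c = c'
      · subst hc
        exact Pair.finsupp_add_self _
      · dsimp only [Prod.swap]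
        rw [cone_cone G p hc]
        exact Pair.finsupp_add_self _
    · rintro ⟨c, c'⟩ - h e
      obtain rfl : c' = c := (Prod.ext_iff.1 e).1
      exact h (cone_cone_self G p c')
  rw [hd, diffPair_eq]
  simp only [map_add, map_sum, pre_pre, post_post, pre_post, pre_cone, post_cone, hcc,
    Finset.sum_add_distrib]
  have key : ∀ a b c : G.Pair →₀ ZMod 2, 0 + a + b + (a + 0 + c) + (b + c + 0) = 0 := by
    intro a b c
    have ha := Pair.finsupp_add_self a
    have hb := Pair.finsupp_add_self b
    have hc := Pair.finsupp_add_self c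
    calc _ = (a + a) + (b + b) + (c + c) := by abel
      _ = 0 := by rw [ha, hb, hc]; simp
  exact key _ _ _

end MarkedGrid

/-! ### Domains and the Maslov grading -/

namespace MarkedGrid
open Equiv
variable {n : ℕ} [NeZero n]

/-- `D` is a domain from `x` to `y`. -/
def IsDomain (x y : Perm (Fin n)) (D : Fin n → Fin n → ℤ) : Prop :=
  ∀ i j, D (i - 1) j + D i (j - 1) - D i j - D (i - 1) (j - 1) =
    (if y i = j then 1 else 0) - (if x i = j then 1 else 0)

/-- The sum of the multiplicities of the four squares around a point. -/
def around (D : Fin n → Fin n → ℤ) (i j : Fin n) : ℤ :=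
  D (i - 1) (j - 1) + D (i - 1) j + D i (j - 1) + D i j

/-- Four times the sum of the average multiplicities at the points of a matching. -/
def pointSum (x : Perm (Fin n)) (D : Fin n → Fin n → ℤ) : ℤ :=
  ∑ i, around D i (x i)

theorem val_sub_one (i : Fin n) : (i - 1).val = if i = 0 then n - 1 else i.val - 1 := by
  have hn := Nat.pos_of_neZero n
  have hi := i.isLt
  have h1 : (1 : Fin n).val = 1 % n := rfl
  rw [Fin.sub_def, h1]
  simp only [Fin.ext_iff, Fin.val_zero]
  rcases Nat.lt_or_ge 1 n with h | h
  · rw [Nat.mod_eq_of_lt h]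
    split_ifs with h0
    · rw [h0, Nat.mod_eq_of_lt (by omega)]; rfl
    · rw [show n - 1 + i.val = (i.val - 1) + n by omega, Nat.add_mod_right,
        Nat.mod_eq_of_lt (by omega)]
  · obtain rfl : n = 1 := by omega
    simp only [Nat.mod_one]
    split_ifs <;> omega

theorem le_sub_one_iff (a i : Fin n) : a ≤ i - 1 ↔ i = 0 ∨ a < i := by
  rw [Fin.le_def, val_sub_one, Fin.lt_def]
  have := a.isLt
  split_ifs with h
  · simp only [h, true_or, iff_true]; omega
  · simp only [h, false_or]
    have : i.val ≠ 0 := fun e => h (Fin.ext e)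
    omega

theorem eq_apply_zero_of_sub_one {α : Type*} (f : Fin n → α) (h : ∀ i, f (i - 1) = f i) (i : Fin n) :
    f i = f 0 := by
  obtain ⟨m, hm⟩ : ∃ m, i.val = m := ⟨_, rfl⟩
  induction m generalizing i with
  | zero => rw [show i = 0 from Fin.ext hm]
  | succ m ih =>
    rw [← h i]
    refine ih _ ?_
    rw [val_sub_one, if_neg (fun e => by simp [e] at hm)]
    omega

/-- A function on the torus whose mixed second difference vanishes is a function of the column plus
a function of the row. Hence two domains with the same endpoints differ by column and row annuli. -/
theorem eq_add_of_mixed {E : Fin n → Fin n → ℤ}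
    (h : ∀ i j, E (i - 1) j + E i (j - 1) - E i j - E (i - 1) (j - 1) = 0) (i j : Fin n) :
    E i j = E i 0 + (E 0 j - E 0 0) := by
  have h1 : ∀ i j, E i j - E i (j - 1) = E 0 j - E 0 (j - 1) := fun i j =>
    eq_apply_zero_of_sub_one (fun i => E i j - E i (j - 1)) (fun i => by
      have := h i j
      linarith) i
  have h2 := eq_apply_zero_of_sub_one (fun j => E i j - E 0 j) (fun j => by
    have := h1 i j
    linarith) j
  linarith

/-- The domain from `x` to `y` which is supported in the fundamental domain. -/
def planar (x y : Perm (Fin n)) (i j : Fin n) : ℤ :=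
  ∑ a, ((if a ≤ i ∧ x a ≤ j then 1 else 0) - (if a ≤ i ∧ y a ≤ j then 1 else 0))

theorem planar_sub_left (x y : Perm (Fin n)) (i j : Fin n) : planar x y (i - 1) j =
    ∑ a, ((if a < i ∧ x a ≤ j then 1 else 0) - (if a < i ∧ y a ≤ j then 1 else 0)) := by
  unfold planar
  simp only [le_sub_one_iff]
  by_cases hi : i = 0
  -- Here `i - 1` wraps around to the last column, where every point is counted and the
  -- contributions of `x` and `y` cancel.
  · subst hi
    simp only [Fin.not_lt_zero, or_false, true_and, false_and, if_false, sub_zero,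
      Finset.sum_const_zero, Finset.sum_sub_distrib]
    rw [Equiv.sum_comp x fun a => if a ≤ j then (1 : ℤ) else 0,
      Equiv.sum_comp y fun a => if a ≤ j then (1 : ℤ) else 0, sub_self]
  · simp only [hi, false_or]

theorem planar_sub_right (x y : Perm (Fin n)) (i j : Fin n) : planar x y i (j - 1) =
    ∑ a, ((if a ≤ i ∧ x a < j then 1 else 0) - (if a ≤ i ∧ y a < j then 1 else 0)) := by
  unfold planar
  simp only [le_sub_one_iff]
  by_cases hj : j = 0
  · subst hj
    simp
  · simp only [hj, false_or]

theorem planar_sub_sub (x y : Perm (Fin n)) (i j : Fin n) : planar x y (i - 1) (j - 1) =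
    ∑ a, ((if a < i ∧ x a < j then 1 else 0) - (if a < i ∧ y a < j then 1 else 0)) := by
  rw [planar_sub_left]
  simp only [le_sub_one_iff]
  by_cases hj : j = 0
  · subst hj
    simp
  · simp only [hj, false_or]

theorem planar_isDomain (x y : Perm (Fin n)) : IsDomain x y (planar x y) := by
  intro i j
  have h1 : (∑ a, if a = i then (if y a = j then (1 : ℤ) else 0) - (if x a = j then 1 else 0)
      else 0) = (if y i = j then 1 else 0) - if x i = j then 1 else 0 := by
    rw [Finset.sum_ite_eq' Finset.univ i, if_pos (Finset.mem_univ i)]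
  rw [← h1, planar_sub_sub, planar_sub_left, planar_sub_right, planar, ← Finset.sum_add_distrib,
    ← Finset.sum_sub_distrib, ← Finset.sum_sub_distrib]
  refine Finset.sum_congr rfl fun a _ => ?_
  have h2 : ∀ b : Fin n, (if b ≤ j then (1 : ℤ) else 0) - (if b < j then 1 else 0) =
      if b = j then 1 else 0 := by
    intro b
    simp only [Fin.lt_def, Fin.le_def, Fin.ext_iff]
    split_ifs <;> omega
  rcases lt_trichotomy a i with h | rfl | h
  · simp only [h, h.le, h.ne, true_and, if_false]
    ring
  · simp only [lt_irrefl, le_refl, false_and, true_and, if_false, if_true, ← h2]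
    ring
  · simp only [h.not_gt, h.not_ge, h.ne', false_and, if_false]
    ring

theorem IsDomain.eq_planar_add {x y : Perm (Fin n)} {D : Fin n → Fin n → ℤ} (h : IsDomain x y D) :
    ∃ s r : Fin n → ℤ, ∀ i j, D i j = planar x y i j + s i + r j := by
  have h' := planar_isDomain x y
  have := eq_add_of_mixed (E := fun i j => D i j - planar x y i j) fun i j => by
    have h1 := h i j
    have h2 := h' i j
    linarith
  exact ⟨fun i => D i 0 - planar x y i 0, fun j => (D 0 j - planar x y 0 j) -
    (D 0 0 - planar x y 0 0), fun i j => by linarith [this i j]⟩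

/-- Twice the Heaviside function, with the value `1` on the diagonal. -/
def step (i a : Fin n) : ℤ := (if a < i then 1 else 0) + (if a ≤ i then 1 else 0)

/-- Summing a quadrant indicator over the four squares at a point factors it into two doubled
Heaviside functions, which turns point averages into the bilinear `pairing`. -/
theorem around_planar (x y : Perm (Fin n)) (i j : Fin n) : around (planar x y) i j =
    ∑ a, (step i a * step j (x a) - step i a * step j (y a)) := by
  rw [around, planar_sub_sub, planar_sub_left, planar_sub_right, planar, ← Finset.sum_add_distrib,
    ← Finset.sum_add_distrib, ← Finset.sum_add_distrib]
  refine Finset.sum_congr rfl fun a _ => ?_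
  simp only [step, ite_and]
  split_ifs <;> ring

theorem step_symm {n : ℕ} (i a : Fin n) : step i a = 2 - step a i := by
  simp only [step, Fin.lt_def, Fin.le_def]
  split_ifs <;> omega

theorem sum_step {n : ℕ} : 2 * ∑ i : Fin n, ∑ a : Fin n, step i a = ∑ _i : Fin n, ∑ _a : Fin n, 2 := by
  rw [two_mul]
  conv_lhs => arg 2; rw [Finset.sum_comm]
  simp only [← Finset.sum_add_distrib]
  refine Finset.sum_congr rfl fun a _ => Finset.sum_congr rfl fun i _ => ?_
  rw [step_symm]; ring

/-- The symmetric pairing counting comparable pairs of points. -/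
def pairing (x y : Perm (Fin n)) : ℤ := ∑ i, ∑ a, step i a * step (x i) (y a)

/-- Reversing both coordinates replaces each `step` by `2 - step`. After expansion the terms linear
in `step` are the same for all permutations, and cancel against the constant. -/
theorem pairing_symm {n : ℕ} (x y : Perm (Fin n)) : pairing x y = pairing y x := by
  have h1 : pairing x y = ∑ i, ∑ a, (2 - step a i) * (2 - step (y a) (x i)) := by
    refine Finset.sum_congr rfl fun i _ => Finset.sum_congr rfl fun a _ => ?_
    rw [step_symm i a, step_symm (x i) (y a)]
  rw [h1, Finset.sum_comm]
  have h2 : ∑ i, ∑ a, step (y i) (x a) = ∑ i : Fin n, ∑ a : Fin n, step i a := by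
    rw [Equiv.sum_comp y fun i => ∑ a, step i (x a)]
    exact Finset.sum_congr rfl fun i _ => Equiv.sum_comp x fun a => step i a
  have h3 := sum_step (n := n)
  have h4 : ∑ i, ∑ a, (2 - step i a) * (2 - step (y i) (x a)) = 2 * (∑ i : Fin n, ∑ a : Fin n, 2) -
      2 * (∑ i : Fin n, ∑ a : Fin n, step i a) - 2 * (∑ i, ∑ a, step (y i) (x a)) + pairing y x := by
    simp only [pairing, Finset.mul_sum, ← Finset.sum_sub_distrib, ← Finset.sum_add_distrib]
    refine Finset.sum_congr rfl fun i _ => Finset.sum_congr rfl fun a _ => ?_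
    ring
  rw [h4, h2]
  linarith

theorem pointSum_planar (x y : Perm (Fin n)) :
    pointSum x (planar x y) + pointSum y (planar x y) = pairing x x - pairing y y := by
  have : ∀ u : Perm (Fin n), pointSum u (planar x y) = pairing u x - pairing u y := by
    intro u
    simp only [pointSum, pairing, around_planar, Finset.sum_sub_distrib]
  rw [this, this, pairing_symm y x]
  ring

theorem pairing_self {n : ℕ} (x : Perm (Fin n)) : pairing x x =
    4 * ((Finset.univ.filter fun p : Fin n × Fin n => p.1 < p.2 ∧ x p.1 < x p.2).card : ℤ) + n := by
  have h1 : ∀ i a, step i a * step (x i) (x a) =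
      4 * (if a < i ∧ x a < x i then 1 else 0) + if a = i then 1 else 0 := by
    intro i a
    by_cases hai : a = i
    · subst hai; simp [step]
    have hx := x.injective.ne hai
    simp only [step, Fin.lt_def, Fin.le_def, Fin.ext_iff, ne_eq] at *
    split_ifs <;> omega
  simp only [pairing, h1, Finset.sum_add_distrib, ← Finset.mul_sum]
  rw [Finset.sum_comm, ← Fintype.sum_prod_type', Finset.sum_boole]
  simp

theorem maslov_sub {n : ℕ} (G : MarkedGrid n) (x y : Perm (Fin n)) :
    4 * (G.maslov x - G.maslov y) = pairing x x - pairing y y - 8 * ∑ i, planar x y i (G.O i) := by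
  have hA : ∑ i, planar x y i (G.O i) =
      ((Finset.univ.filter fun p : Fin n × Fin n => p.1 ≤ p.2 ∧ x p.1 ≤ G.O p.2).card : ℤ) -
      ((Finset.univ.filter fun p : Fin n × Fin n => p.1 ≤ p.2 ∧ y p.1 ≤ G.O p.2).card : ℤ) := by
    simp only [planar, Finset.sum_sub_distrib]
    rw [Finset.sum_comm, ← Fintype.sum_prod_type', Finset.sum_boole]
    congr 1
    rw [Finset.sum_comm, ← Fintype.sum_prod_type', Finset.sum_boole]
  -- By inclusion-exclusion, the two mixed counts in the Maslov grading differ by a constant that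
  -- does not depend on `u`.
  have hB : ∀ u : Perm (Fin n),
      ((Finset.univ.filter fun p : Fin n × Fin n => p.1 < p.2 ∧ G.O p.1 < u p.2).card : ℤ) =
      ((Finset.univ.filter fun p : Fin n × Fin n => p.1 ≤ p.2 ∧ u p.1 ≤ G.O p.2).card : ℤ) +
      ((∑ i : Fin n, ∑ a : Fin n, 1) - (∑ i : Fin n, ∑ a : Fin n, if a ≤ i then 1 else 0) -
        ∑ i, ∑ a, if a ≤ G.O i then 1 else 0) := by
    intro u
    have e1 : (∑ i, ∑ a, if a ≤ G.O i then (1 : ℤ) else 0) =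
        ∑ i, ∑ a, if u a ≤ G.O i then (1 : ℤ) else 0 :=
      Finset.sum_congr rfl fun i _ => (Equiv.sum_comp u fun a => if a ≤ G.O i then (1 : ℤ) else 0).symm
    rw [e1, ← Finset.sum_boole, ← Finset.sum_boole]
    rw [Fintype.sum_prod_type, Fintype.sum_prod_type]
    rw [Finset.sum_comm (f := fun a i => if a ≤ i ∧ u a ≤ G.O i then (1 : ℤ) else 0)]
    simp only [← Finset.sum_sub_distrib, ← Finset.sum_add_distrib]
    refine Finset.sum_congr rfl fun i _ => Finset.sum_congr rfl fun a _ => ?_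
    simp only [Fin.lt_def, Fin.le_def]
    split_ifs <;> omega
  rw [hA, pairing_self, pairing_self, maslov, maslov, hB x, hB y]
  ring

theorem pointSum_add (x : Perm (Fin n)) (D : Fin n → Fin n → ℤ) (s r : Fin n → ℤ) :
    pointSum x (fun i j => D i j + s i + r j) = pointSum x D + 4 * ∑ i, s i + 4 * ∑ j, r j := by
  have hs : ∑ i, s (i - 1) = ∑ i, s i := Equiv.sum_comp (Equiv.subRight 1) s
  have hr : ∑ i, r (x i) = ∑ i, r i := Equiv.sum_comp x r
  have hr' : ∑ i, r (x i - 1) = ∑ i, r i := by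
    rw [Equiv.sum_comp x fun i => r (i - 1)]
    exact Equiv.sum_comp (Equiv.subRight 1) r
  have : pointSum x (fun i j => D i j + s i + r j) = pointSum x D +
      2 * (∑ i, s (i - 1) + ∑ i, s i) + 2 * (∑ i, r (x i) + ∑ i, r (x i - 1)) := by
    simp only [pointSum, around, ← Finset.sum_add_distrib, Finset.mul_sum]
    refine Finset.sum_congr rfl fun i _ => ?_
    ring
  rw [this, hs, hr, hr']
  ring

/-- This is the index formula of a domain by point averages. An annulus adds 4 to each `pointSum`
and contains one `O`, so the right-hand side is unchanged by annuli and it suffices to treat `planar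
x y`. -/
theorem IsDomain.maslov_sub {G : MarkedGrid n} {x y : Perm (Fin n)} {D : Fin n → Fin n → ℤ}
    (h : IsDomain x y D) :
    4 * (G.maslov x - G.maslov y) = pointSum x D + pointSum y D - 8 * ∑ i, D i (G.O i) := by
  obtain ⟨s, r, hD⟩ := h.eq_planar_add
  obtain rfl : D = fun i j => planar x y i j + s i + r j := by
    funext i j
    exact hD i j
  rw [pointSum_add, pointSum_add, MarkedGrid.maslov_sub]
  have := pointSum_planar x y
  simp only [Finset.sum_add_distrib, Equiv.sum_comp G.O r]
  linarith

end MarkedGrid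

/-! ### Rectangles as domains, and their index -/

namespace MarkedGrid
open Equiv
variable {n : ℕ} [NeZero n]

/-- The indicator function of a half-open cyclic interval. -/
def arc (a b i : Fin n) : ℤ := if InArc a b i then 1 else 0

theorem arc_nonneg (a b i : Fin n) : 0 ≤ arc a b i := by
  unfold arc; split_ifs <;> norm_num

theorem arc_sub_one (a b i : Fin n) :
    arc a b (i - 1) = arc a b i + (if i = b then 1 else 0) - if i = a then 1 else 0 := by
  have hv := val_sub_one i
  simp only [arc, inArc_iff, Fin.lt_def, Fin.le_def, Fin.ext_iff, hv, Fin.val_zero] at *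
  have := i.isLt
  have := a.isLt
  have := b.isLt
  by_cases h0 : i.val = 0
  · rw [if_pos h0]
    split_ifs <;> omega
  · rw [if_neg h0]
    split_ifs <;> omega

theorem arc_left {a b : Fin n} (hab : a ≠ b) : arc a b a = 1 := if_pos (inArc_left hab)

theorem not_inArc_right (a b : Fin n) : ¬ InArc a b b := lt_irrefl _

theorem arc_right (a b : Fin n) : arc a b b = 0 := if_neg (not_inArc_right a b)

theorem ne_add_one (hn : 1 < n) (c : Fin n) : c ≠ c + 1 := by
  intro h
  have h1 : (1 : Fin n) = 0 := by simpa using h.symm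
  have h2 : (1 : Fin n).val = 1 % n := rfl
  rw [h1, Nat.mod_eq_of_lt hn] at h2
  simp at h2

theorem arc_add_one (hn : 1 < n) (c i : Fin n) : arc c (c + 1) i = if i = c then 1 else 0 := by
  have h2 := val_sub_one (c + 1)
  have h3 := ne_add_one hn c
  rw [add_sub_cancel_right] at h2
  have := i.isLt
  have := c.isLt
  have := (c + 1).isLt
  generalize c + 1 = b at *
  simp only [arc, inArc_iff, Fin.lt_def, Fin.le_def, ne_eq, Fin.ext_iff, Fin.val_zero] at *
  split_ifs at * <;> omega

namespace IsDomain

variable {x y z : Perm (Fin n)} {D E : Fin n → Fin n → ℤ}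

theorem add (h : IsDomain x y D) (h' : IsDomain y z E) : IsDomain x z fun i j => D i j + E i j := by
  intro i j
  have h1 := h i j
  have h2 := h' i j
  linarith

theorem sub (h : IsDomain x y D) (h' : IsDomain x z E) : IsDomain z y fun i j => D i j - E i j := by
  intro i j
  have h1 := h i j
  have h2 := h' i j
  linarith

/-- Column annuli are domains from `x` to itself. -/
theorem col (x : Perm (Fin n)) (s : Fin n → ℤ) : IsDomain x x fun i _ => s i := by
  intro i j
  simp

/-- Row annuli are domains from `x` to itself. -/
theorem row (x : Perm (Fin n)) (s : Fin n → ℤ) : IsDomain x x fun _ j => s j := by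
  intro i j
  simp

end IsDomain

/-- The domain of a rectangle. -/
def rect (x : Perm (Fin n)) (a b i j : Fin n) : ℤ := arc a b i * arc (x a) (x b) j

theorem rect_nonneg (x : Perm (Fin n)) (a b i j : Fin n) : 0 ≤ rect x a b i j :=
  mul_nonneg (arc_nonneg _ _ _) (arc_nonneg _ _ _)

theorem isDomain_rect (x : Perm (Fin n)) {a b : Fin n} (hab : a ≠ b) :
    IsDomain x (x * swap a b) (rect x a b) := by
  intro i j
  have hx := x.injective.ne hab
  have key : (if (x * swap a b) i = j then (1 : ℤ) else 0) - (if x i = j then 1 else 0) =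
      ((if i = b then 1 else 0) - if i = a then 1 else 0) *
        ((if j = x a then 1 else 0) - if j = x b then 1 else 0) := by
    by_cases ha : i = a
    · subst ha
      rw [mul_swap_left]
      simp only [hab, if_true, if_false, eq_comm (a := j)]
      ring
    by_cases hb : i = b
    · subst hb
      rw [mul_swap_right]
      simp only [ha, if_true, if_false, eq_comm (a := j)]
      ring
    rw [mul_swap_of_ne x ha hb]
    simp [ha, hb]
  rw [key]
  simp only [rect, arc_sub_one]
  ring

theorem rectO_eq (G : MarkedGrid n) (W : Finset (Fin n)) (x : Perm (Fin n)) (r : Fin n × Fin n)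
    (i : Fin n) : (G.rectO W x r i : ℤ) = if i ∉ W then rect x r.1 r.2 i (G.O i) else 0 := by
  simp only [rectO, rect, arc]
  split_ifs <;> simp_all

/-- The points of a matching in the interior of a rectangle. -/
def interiorPoints (x : Perm (Fin n)) (a b : Fin n) : Finset (Fin n) :=
  Finset.univ.filter fun i => (i ≠ a ∧ InArc a b i) ∧ (x i ≠ x a ∧ InArc (x a) (x b) (x i))

/-- In the index formula each of the four corners has average multiplicity one quarter, and each
interior point, which belongs to both matchings, has average one. -/
theorem maslov_rect (G : MarkedGrid n) (x : Perm (Fin n)) {a b : Fin n} (hab : a ≠ b) :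
    G.maslov x - G.maslov (x * swap a b) =
      1 + 2 * (interiorPoints x a b).card - 2 * ∑ i, rect x a b i (G.O i) := by
  have hx := x.injective.ne hab
  have key : ∀ z : Perm (Fin n), (∀ i, i ≠ a → i ≠ b → z i = x i) →
      (z a = x a ∨ z a = x b) → (z b = x a ∨ z b = x b) →
      pointSum z (rect x a b) = 2 + 4 * (interiorPoints x a b).card := by
    intro z hz ha hb
    have h1 : ∀ i, around (rect x a b) i (z i) = (if i = a then 1 else 0) + (if i = b then 1 else 0)
        + 4 * if (i ≠ a ∧ InArc a b i) ∧ (x i ≠ x a ∧ InArc (x a) (x b) (x i)) then 1 else 0 := by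
      intro i
      have h2 : around (rect x a b) i (z i) =
          (arc a b (i - 1) + arc a b i) * (arc (x a) (x b) (z i - 1) + arc (x a) (x b) (z i)) := by
        simp only [around, rect]; ring
      rw [h2, arc_sub_one, arc_sub_one]
      by_cases hia : i = a
      · subst hia
        simp only [arc_left hab, hab, if_true, if_false]
        rcases ha with ha | ha <;> rw [ha]
        · simp [arc_left hx, hx]
        · simp [arc_right, hx.symm]
      by_cases hib : i = b
      · subst hib
        simp only [arc_right, hab.symm, if_true, if_false]
        rcases hb with hb | hb <;> rw [hb]
        · simp [arc_left hx, hx, not_inArc_right]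
        · simp [arc_right, hx.symm, not_inArc_right]
      rw [hz i hia hib]
      have h3 := x.injective.ne hia
      have h4 := x.injective.ne hib
      simp only [hia, hib, h3, h4, if_false, arc, ne_eq, not_false_eq_true, true_and]
      split_ifs <;> simp_all
    simp only [pointSum, h1, Finset.sum_add_distrib, ← Finset.mul_sum, Finset.sum_boole,
      interiorPoints]
    simp [Finset.filter_eq']
  have h := (isDomain_rect x hab).maslov_sub (G := G)
  rw [key x (fun _ _ _ => rfl) (.inl rfl) (.inr rfl), key (x * swap a b)
    (fun i h h' => mul_swap_of_ne x h h') (.inr (mul_swap_left _ _ _))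
    (.inl (mul_swap_right _ _ _))] at h
  linarith

/-- An empty rectangle has index one. -/
theorem IsEmptyRect.maslov_sub {G : MarkedGrid n} {W : Finset (Fin n)} {x : Perm (Fin n)}
    {r : Fin n × Fin n} (h : IsEmptyRect W x r.1 r.2) (hx : ∀ c ∈ W, x c = G.O c) :
    G.maslov x - G.maslov (x * swap r.1 r.2) = 1 - 2 * ∑ i, (G.rectO W x r i : ℤ) := by
  obtain ⟨hab, ha, hb, h⟩ := h
  -- The only interior points left lie on removed circles. Each is the lower left corner of the
  -- square of its `O`, and lies inside exactly when the rectangle covers that `O`; so they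
  -- compensate for the `O`'s that are not counted.
  have h1 : ((interiorPoints x r.1 r.2).card : ℤ) =
      ∑ i, if i ∈ W then rect x r.1 r.2 i (G.O i) else 0 := by
    rw [interiorPoints, ← Finset.sum_boole]
    refine Finset.sum_congr rfl fun i _ => ?_
    by_cases hi : i ∈ W
    · have h2 : i ≠ r.1 := fun e => ha (e ▸ hi)
      have h3 := x.injective.ne h2
      rw [if_pos hi, ← hx i hi]
      simp only [rect, arc, h2, h3, ne_eq, not_false_eq_true, true_and]
      split_ifs <;> simp_all
    · rw [if_neg hi, if_neg (h i hi)]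
  have h4 : ∑ i, rect x r.1 r.2 i (G.O i) = (∑ i, if i ∈ W then rect x r.1 r.2 i (G.O i) else 0) +
      ∑ i, (G.rectO W x r i : ℤ) := by
    rw [← Finset.sum_add_distrib]
    refine Finset.sum_congr rfl fun i _ => ?_
    rw [rectO_eq]
    split_ifs <;> simp_all
  rw [maslov_rect G x hab, h1, h4]
  ring

end MarkedGrid

/-! ### Positive pairs form a subcomplex -/

namespace MarkedGrid
open Equiv
variable {n : ℕ} [NeZero n] {G : MarkedGrid n}

/-- The markings as integers, extended by zero. -/
def Pair.eps {n : ℕ} {G : MarkedGrid n} (P : G.Pair) (i : Fin n) : ℤ :=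
  if h : i ∈ G.Z then ((P.ε ⟨i, h⟩).toNat : ℤ) else 0

theorem Pair.eps_coe {n : ℕ} {G : MarkedGrid n} (P : G.Pair) (c : G.Z) :
    P.eps c = ((P.ε c).toNat : ℤ) :=
  dif_pos c.2

theorem Pair.index_eq {n : ℕ} {G : MarkedGrid n} (P : G.Pair) :
    P.index = G.maslov P.x - G.maslov P.y.1 - ∑ c ∈ G.Z, P.eps c + 2 * ∑ i, (P.N i : ℤ) := by
  have h : ∑ c : G.Z, ((P.ε c).toNat : ℤ) = ∑ c ∈ G.Z, P.eps c := by
    simp only [← Pair.eps_coe]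
    exact Finset.sum_coe_sort G.Z P.eps
  rw [Pair.index, h]
  ring

/-- The domain `D` with fake multiplicities `f` shows that the pair `P` is positive. -/
structure Pair.Cert (P : G.Pair) (D : Fin n → Fin n → ℤ) (f : Fin n → ℤ) : Prop where
  dom : IsDomain P.x P.y.1 D
  nonneg : ∀ i j, 0 ≤ D i j
  fake : ∀ i, i ∉ G.Z → f i = 0
  le : ∀ c ∈ G.Z, f c ≤ D (c - 1) (G.O c) ∧ f c ≤ D c (G.O c) ∧
    f c + P.eps c - 1 ≤ D (c - 1) (G.O c - 1) ∧ f c + P.eps c ≤ D c (G.O c - 1)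
  exp : ∀ i, (P.N i : ℤ) = D i (G.O i) - f i

theorem Pair.isPositive_iff (P : G.Pair) : P.IsPositive ↔ ∃ D f, P.Cert D f := by
  classical
  constructor
  · rintro ⟨E, ⟨h0, h1⟩, hx, hy, hε, hN⟩
    refine ⟨E.D, fun i => if h : i ∈ G.Z then E.fake ⟨i, h⟩ else 0, ?_, h0, ?_, ?_, ?_⟩
    · intro i j
      rw [← hx, ← hy]
      exact E.boundary i j
    · intro i hi
      exact dif_neg hi
    · intro c hc
      have := h1 ⟨c, hc⟩
      rw [hε] at this
      simpa only [Pair.eps, dif_pos hc] using this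
    · intro i
      rw [← hN, EnhancedDomain.exponent]
      split_ifs
      · simp [EnhancedDomain.fake]
      · simp
  · rintro ⟨D, f, h⟩
    have hf : ∀ c : G.Z, D c (G.O c) - (D c (G.O c) - f c) = f c := fun c => by ring
    refine ⟨⟨P.x, P.y, D, h.dom, P.ε, fun c => D c (G.O c) - f c⟩, ⟨h.nonneg, fun c => ?_⟩,
      rfl, rfl, rfl, fun i => ?_⟩
    · have := h.le c c.2
      rw [P.eps_coe c] at this
      simpa only [EnhancedDomain.fake, hf] using this
    · rw [h.exp, EnhancedDomain.exponent]
      split_ifs with hi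
      · rfl
      · simp [h.fake i hi]

/-- The terms of the differential. -/
inductive Pair.Arrow (P : G.Pair) : G.Pair → Prop
  | pre (x' : Perm (Fin n)) (r : Fin n × Fin n) (h : IsEmptyRect ∅ x' r.1 r.2)
      (hx : P.x = x' * swap r.1 r.2) : Arrow P ⟨x', P.y, P.ε, P.N + G.rectO ∅ x' r⟩
  | post (y' : G.DestabState) (r : Fin n × Fin n) (h : IsEmptyRect G.Z P.y.1 r.1 r.2)
      (hy : y'.1 = P.y.1 * swap r.1 r.2) : Arrow P ⟨P.x, y', P.ε, P.N + G.rectO G.Z P.y.1 r⟩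
  | marked (c : G.Z) (h : P.ε c = false) :
      Arrow P ⟨P.x, P.y, Function.update P.ε c true, P.N + Pi.single (c : Fin n) 1⟩
  | below (c : G.Z) (h : P.ε c = false) :
      Arrow P ⟨P.x, P.y, Function.update P.ε c true, P.N + Pi.single (G.O.symm (G.O c - 1)) 1⟩

theorem diffPair_mem_supported {P : G.Pair} {S : Set G.Pair} (h : ∀ Q, P.Arrow Q → Q ∈ S) :
    G.diffPair P ∈ Finsupp.supported (ZMod 2) (ZMod 2) S := by
  rw [diffPair]
  refine add_mem (add_mem ?_ ?_) ?_
  · refine sum_mem fun x' _ => sum_mem fun r hr => Finsupp.single_mem_supported _ _ (h _ ?_)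
    rw [mem_emptyRect] at hr
    exact .pre x' r hr.1 hr.2
  · refine sum_mem fun y' _ => sum_mem fun r hr => Finsupp.single_mem_supported _ _ (h _ ?_)
    rw [mem_emptyRect] at hr
    exact .post y' r hr.1 hr.2
  · refine sum_mem fun c _ => ?_
    split_ifs with hc
    · exact sub_mem (Finsupp.single_mem_supported _ _ (h _ (.marked c hc)))
        (Finsupp.single_mem_supported _ _ (h _ (.below c hc)))
    · exact zero_mem _

theorem Pair.arrow_of_mem_support {P Q : G.Pair} (h : Q ∈ (G.diffPair P).support) : P.Arrow Q :=
  (Finsupp.mem_supported _ _).1 (diffPair_mem_supported (S := {Q | P.Arrow Q}) fun _ h => h) h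

theorem sum_eps_update {n : ℕ} {G : MarkedGrid n} (P Q : G.Pair) (c : G.Z) (h : P.ε c = false)
    (hQ : Q.ε = Function.update P.ε c true) : ∑ i ∈ G.Z, Q.eps i = ∑ i ∈ G.Z, P.eps i + 1 := by
  classical
  rw [← Finset.add_sum_erase _ _ c.2, ← Finset.add_sum_erase _ P.eps c.2, Pair.eps_coe,
    Pair.eps_coe, hQ, h, Function.update_self]
  have : ∑ i ∈ G.Z.erase c, Q.eps i = ∑ i ∈ G.Z.erase c, P.eps i := by
    refine Finset.sum_congr rfl fun i hi => ?_
    have hi' := Finset.mem_of_mem_erase hi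
    have hic : (⟨i, hi'⟩ : G.Z) ≠ c := fun e => (Finset.ne_of_mem_erase hi) (by rw [← e])
    simp only [Pair.eps, dif_pos hi', hQ, Function.update_of_ne hic]
  rw [this]
  simp
  ring

/-- The differential raises the index by one. -/
theorem Pair.Arrow.index {P Q : G.Pair} (h : P.Arrow Q) : Q.index = P.index + 1 := by
  rw [Pair.index_eq, Pair.index_eq]
  cases h with
  | pre x' r h hx =>
    have h1 := h.maslov_sub (G := G) (by simp)
    rw [← hx] at h1
    simp only [Pi.add_apply, Nat.cast_add, Finset.sum_add_distrib]
    have : ∀ i, Pair.eps ⟨x', P.y, P.ε, P.N + G.rectO ∅ x' r⟩ i = P.eps i := fun _ => rfl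
    simp only [this]
    linarith
  | post y' r h hy =>
    have h1 := h.maslov_sub P.y.2
    rw [← hy] at h1
    simp only [Pi.add_apply, Nat.cast_add, Finset.sum_add_distrib]
    have : ∀ i, Pair.eps ⟨P.x, y', P.ε, P.N + G.rectO G.Z P.y.1 r⟩ i = P.eps i := fun _ => rfl
    simp only [this]
    linarith
  | marked c h =>
    rw [sum_eps_update P _ c h rfl]
    simp only [Pi.add_apply, Nat.cast_add, Finset.sum_add_distrib, ← Nat.cast_sum]
    simp
    ring
  | below c h =>
    rw [sum_eps_update P _ c h rfl]
    simp only [Pi.add_apply, Nat.cast_add, Finset.sum_add_distrib, ← Nat.cast_sum]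
    simp
    ring

theorem arc_sub_one_of_ne {a b i : Fin n} (ha : i ≠ a) (hb : i ≠ b) :
    arc a b (i - 1) = arc a b i := by
  rw [arc_sub_one, if_neg ha, if_neg hb]
  ring

theorem eps_update {n : ℕ} {G : MarkedGrid n} (P Q : G.Pair) (c : G.Z) (h : P.ε c = false)
    (hQ : Q.ε = Function.update P.ε c true) (i : Fin n) :
    Q.eps i = P.eps i + if i = c then 1 else 0 := by
  by_cases hi : i ∈ G.Z
  · lift i to G.Z using hi
    rw [Pair.eps_coe, Pair.eps_coe, hQ]
    by_cases hic : i = c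
    · subst hic
      simp [h]
    · rw [Function.update_of_ne hic, if_neg fun e => hic (Subtype.ext e), add_zero]
  · rw [Pair.eps, dif_neg hi, Pair.eps, dif_neg hi, if_neg, add_zero]
    rintro rfl
    exact hi c.2

/-- The differential preserves positivity. -/
theorem Pair.Arrow.isPositive {P Q : G.Pair} (h : P.Arrow Q) (hP : P.IsPositive) :
    Q.IsPositive := by
  rw [Pair.isPositive_iff] at *
  obtain ⟨D, f, hD⟩ := hP
  cases h with
  | pre x' r h hx =>
    refine ⟨fun i j => rect x' r.1 r.2 i j + D i j, f, ?_, ?_, hD.fake, ?_, ?_⟩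
    · refine (isDomain_rect x' h.1).add ?_
      rw [← hx]
      exact hD.dom
    · exact fun i j => add_nonneg (rect_nonneg _ _ _ _ _) (hD.nonneg i j)
    · intro c hc
      have h1 := hD.le c hc
      have h2 := rect_nonneg x' r.1 r.2
      exact ⟨by linarith [h2 (c - 1) (G.O c)], by linarith [h2 c (G.O c)],
        by simp only [Pair.eps] at *; linarith [h2 (c - 1) (G.O c - 1)],
        by simp only [Pair.eps] at *; linarith [h2 c (G.O c - 1)]⟩
    · intro i
      have := rectO_eq G ∅ x' r i
      simp only [Finset.notMem_empty, not_false_eq_true, if_true] at this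
      simp only [Pi.add_apply, Nat.cast_add, hD.exp, this]
      ring
  | post y' r h hy =>
    -- The edges of a destabilized rectangle avoid the circles through the destabilization points,
    -- so the four squares at such a point gain the same multiplicity. Counting it as fake keeps all
    -- inequalities and the exponent.
    refine ⟨fun i j => D i j + rect P.y.1 r.1 r.2 i j,
      fun i => f i + if i ∈ G.Z then rect P.y.1 r.1 r.2 i (G.O i) else 0, ?_, ?_, ?_, ?_, ?_⟩
    · have h1 := hD.dom.add (isDomain_rect P.y.1 h.1)
      rw [← hy] at h1
      exact h1
    · exact fun i j => add_nonneg (hD.nonneg i j) (rect_nonneg _ _ _ _ _)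
    · intro i hi
      rw [hD.fake i hi, if_neg hi, add_zero]
    · intro c hc
      obtain ⟨h1, h2, h3, h4⟩ := hD.le c hc
      have ha : c ≠ r.1 := fun e => h.2.1 (e ▸ hc)
      have hb : c ≠ r.2 := fun e => h.2.2.1 (e ▸ hc)
      have ha' := P.y.1.injective.ne ha
      have hb' := P.y.1.injective.ne hb
      rw [P.y.2 c hc] at ha' hb'
      simp only [if_pos hc, rect, arc_sub_one_of_ne ha hb, arc_sub_one_of_ne ha' hb', Pair.eps]
        at h1 h2 h3 h4 ⊢
      refine ⟨?_, ?_, ?_, ?_⟩ <;> linarith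
    · intro i
      have := rectO_eq G G.Z P.y.1 r i
      simp only [Pi.add_apply, Nat.cast_add, hD.exp, this]
      split_ifs <;> simp_all; ring
  | marked c h =>
    -- One unit of fake multiplicity becomes real, which produces the factor `U_c`. The lower
    -- inequalities keep their bound because `f + ε` does not change.
    refine ⟨D, fun i => f i - if i = c then 1 else 0, hD.dom, hD.nonneg, ?_, ?_, ?_⟩
    · intro i hi
      rw [hD.fake i hi, if_neg, sub_zero]
      rintro rfl
      exact hi c.2
    · intro i hi
      obtain ⟨h1, h2, h3, h4⟩ := hD.le i hi
      rw [eps_update P _ c h rfl]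
      split_ifs <;> refine ⟨?_, ?_, ?_, ?_⟩ <;> linarith
    · intro i
      simp only [Pi.add_apply, Nat.cast_add, hD.exp, Pi.single_apply]
      split_ifs
      · push_cast; ring
      · simp
  | below c h =>
    -- The row annulus just below the point raises both lower multiplicities by one, as the new
    -- marking requires, and contains exactly the `O` of that row.
    refine ⟨fun i j => D i j + if j = G.O c - 1 then 1 else 0, f, ?_, ?_, hD.fake, ?_, ?_⟩
    · exact hD.dom.add (IsDomain.row P.y.1 fun j => if j = G.O c - 1 then 1 else 0)
    · intro i j
      have := hD.nonneg i j
      split_ifs <;> linarith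
    · intro i hi
      obtain ⟨h1, h2, h3, h4⟩ := hD.le i hi
      rw [eps_update P _ c h rfl]
      by_cases hic : i = c
      · subst hic
        simp only [if_true]
        refine ⟨?_, ?_, ?_, ?_⟩ <;> (try split_ifs) <;> linarith
      · simp only [if_neg hic]
        refine ⟨?_, ?_, ?_, ?_⟩ <;> split_ifs <;> linarith
    · intro i
      simp only [Pi.add_apply, Nat.cast_add, hD.exp, Pi.single_apply]
      simp only [← Equiv.symm_apply_eq, eq_comm (a := i), eq_comm (a := G.O i)]
      split_ifs <;> simp_all; ring

theorem diff_mem_CP {d : ℤ} {f : G.Pair →₀ ZMod 2} (hf : f ∈ G.CP d) : G.diff f ∈ G.CP (d + 1) := by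
  rw [diff, Finsupp.linearCombination_apply]
  refine sum_mem fun P hP => Submodule.smul_mem _ _ (diffPair_mem_supported fun Q hQ => ?_)
  have hP' := (Finsupp.mem_supported _ _).1 hf hP
  exact ⟨hQ.isPositive hP'.1, by rw [hQ.index, hP'.2]⟩

end MarkedGrid

/-! ### Free destabilization points and flips -/

namespace MarkedGrid
open Equiv
variable {n : ℕ} [NeZero n] {G : MarkedGrid n}

/-- Along a column, the difference of the multiplicities on the two sides of a vertical circle
jumps only at the points of the matchings. -/
theorem IsDomain.sub_add_arc {x y : Perm (Fin n)} {D : Fin n → Fin n → ℤ} (h : IsDomain x y D)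
    (c j j' : Fin n) : D c j - D (c - 1) j + arc (y c) (x c) j =
      D c j' - D (c - 1) j' + arc (y c) (x c) j' := by
  have key := eq_apply_zero_of_sub_one (fun j => D c j - D (c - 1) j + arc (y c) (x c) j)
    fun j => by
      have h1 := h c j
      simp only [arc_sub_one, eq_comm (a := j)]
      linarith
  exact (key j).trans (key j').symm

theorem around_nonneg {D : Fin n → Fin n → ℤ} (hD : ∀ i j, 0 ≤ D i j) (i j : Fin n) :
    0 ≤ around D i j := by
  have := hD (i - 1) (j - 1)
  have := hD (i - 1) j
  have := hD i (j - 1)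
  have := hD i j
  rw [around]
  linarith

theorem IsSparse.add_one_notMem (hn : 1 < n) (hG : G.IsSparse) {c : Fin n} (hc : c ∈ G.Z) :
    c + 1 ∉ G.Z :=
  fun h => (hG c hc (c + 1) h (ne_add_one hn c)).1 rfl

theorem IsSparse.sub_one_notMem (hn : 1 < n) (hG : G.IsSparse) {c : Fin n} (hc : c ∈ G.Z) :
    c - 1 ∉ G.Z := fun h =>
  hG.add_one_notMem hn h (by rwa [sub_add_cancel])

/-- By sparseness the marked columns and their right neighbours are disjoint, so contributions on
both circles may be used. -/
theorem IsSparse.sum_add_sum_le (hn : 1 < n) (hG : G.IsSparse) {F : Fin n → ℤ} (hF : ∀ i, 0 ≤ F i) :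
    ∑ c ∈ G.Z, F c + ∑ c ∈ G.Z, F (c + 1) ≤ ∑ i, F i := by
  classical
  have h1 : ∑ c ∈ G.Z, F (c + 1) = ∑ c ∈ G.Z.image (· + 1), F c :=
    (Finset.sum_image fun _ _ _ _ h => add_right_cancel h).symm
  rw [h1, ← Finset.sum_union]
  · exact Finset.sum_le_sum_of_subset_of_nonneg (Finset.subset_univ _) fun i _ _ => hF i
  · rw [Finset.disjoint_right]
    intro i hi
    obtain ⟨c, hc, rfl⟩ := Finset.mem_image.1 hi
    exact hG.add_one_notMem hn hc

/-- The right-hand side is the sum of the average multiplicities over `x` and `y`. With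
multiplicities `a, b, c, d` around a point common to both, the circle `c` contributes `4 (a + d)` to
four times this sum, and the next circle at least `4 (b - a)`. The total is at least `4 (b + d)`,
which gives the term with `δ`. -/
theorem sum_le_index_of_fixed (hn : 1 < n) (hG : G.IsSparse) {x y : Perm (Fin n)}
    {D : Fin n → Fin n → ℤ} {f e δ : Fin n → ℤ} (hD : IsDomain x y D) (h0 : ∀ i j, 0 ≤ D i j)
    (hy : ∀ c ∈ G.Z, y c = G.O c) (hx : ∀ c ∈ G.Z, x c = G.O c)
    (h : ∀ c ∈ G.Z, f c ≤ D (c - 1) (G.O c) ∧ f c + δ c ≤ D c (G.O c) ∧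
      f c + e c - 1 ≤ D (c - 1) (G.O c - 1) ∧ f c + e c ≤ D c (G.O c - 1))
    (hδ : ∀ c ∈ G.Z, δ c = 0 ∨ δ c = 1) :
    ∑ c ∈ G.Z, (2 * f c + e c + δ c) ≤
      G.maslov x - G.maslov y + 2 * ∑ i, D i (G.O i) := by
  have h1 := hG.sum_add_sum_le hn (F := fun i => around D i (x i) + around D i (y i))
    fun i => add_nonneg (around_nonneg h0 _ _) (around_nonneg h0 _ _)
  rw [Finset.sum_add_distrib (s := Finset.univ)] at h1
  have h2 := hD.maslov_sub (G := G)
  have h3 : ∑ c ∈ G.Z, 4 * (2 * f c + e c + δ c) ≤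
      ∑ c ∈ G.Z, ((around D c (x c) + around D c (y c)) +
        (around D (c + 1) (x (c + 1)) + around D (c + 1) (y (c + 1)))) := by
    refine Finset.sum_le_sum fun c hc => ?_
    obtain ⟨ha, hb, hc', hd⟩ := h c hc
    -- Since `x` and `y` agree on the circle `c`, the jump of `D` across it is constant along the
    -- circle, and by nonnegativity it bounds column `c` from below.
    have h4 : ∀ j, 2 * (D c (G.O c) - D (c - 1) (G.O c)) ≤ around D (c + 1) j := by
      intro j
      have hj : ∀ j, D c (G.O c) - D (c - 1) (G.O c) ≤ D c j := by
        intro j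
        have := hD.sub_add_arc c j (G.O c)
        rw [hx c hc, hy c hc] at this
        simp only [arc, InArc, sub_self, Fin.not_lt_zero, if_false] at this
        linarith [h0 (c - 1) j]
      rw [around, add_sub_cancel_right]
      linarith [hj j, hj (j - 1), h0 (c + 1) j, h0 (c + 1) (j - 1)]
    -- No corner occurs at the common point, so `a + d = b + c` around it; this removes the `-1` in
    -- the lower left inequality.
    have h5 := hD c (G.O c)
    rw [hx c hc, hy c hc, sub_self] at h5
    have h6 := h4 (x (c + 1))
    have h7 := h4 (y (c + 1))
    have h8 := around_nonneg h0 (c + 1) (x (c + 1))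
    have h9 := around_nonneg h0 (c + 1) (y (c + 1))
    rw [hx c hc, hy c hc, around]
    rcases hδ c hc with e | e <;> rw [e] at hb ⊢ <;> omega
  rw [Finset.sum_add_distrib (g := fun c => around D (c + 1) (x (c + 1)) +
    around D (c + 1) (y (c + 1))), ← Finset.mul_sum] at h3
  simp only [pointSum] at h2
  linarith

/-- The thin rectangle exchanging the points on two adjacent vertical circles. -/
theorem maslov_thin (hn : 1 < n) (x : Perm (Fin n)) (c : Fin n) :
    G.maslov x - G.maslov (x * swap c (c + 1)) =
      1 - 2 * ∑ i, rect x c (c + 1) i (G.O i) := by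
  rw [maslov_rect G x (ne_add_one hn c)]
  have : interiorPoints x c (c + 1) = ∅ := by
    refine Finset.filter_eq_empty_iff.2 fun i _ h => ?_
    have := arc_add_one hn c i
    rw [arc, if_pos h.1.2, if_neg h.1.1] at this
    exact one_ne_zero this
  rw [this]
  simp

/-- A point of `x` at the lower right corner of the square of `O_c` is moved to the destabilization
point by prepending a thin rectangle. This raises the index by one, and also the multiplicity at
`O_c`. The gain is recorded in `δ`, so that the inequality before the move follows from the stronger
one after it. -/
theorem sum_le_index (hn : 1 < n) (hG : G.IsSparse) {x y : Perm (Fin n)}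
    {D : Fin n → Fin n → ℤ} {f e δ : Fin n → ℤ} (hD : IsDomain x y D) (h0 : ∀ i j, 0 ≤ D i j)
    (hy : ∀ c ∈ G.Z, y c = G.O c) (hx : ∀ c ∈ G.Z, x c = G.O c ∨ x (c + 1) = G.O c)
    (h : ∀ c ∈ G.Z, f c ≤ D (c - 1) (G.O c) ∧ f c + δ c ≤ D c (G.O c) ∧
      f c + e c - 1 ≤ D (c - 1) (G.O c - 1) ∧ f c + e c ≤ D c (G.O c - 1))
    (hδ : ∀ c ∈ G.Z, δ c = 0 ∨ δ c = 1 ∧ x c = G.O c) :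
    ∑ c ∈ G.Z, (2 * f c + e c + δ c) ≤
      G.maslov x - G.maslov y + 2 * ∑ i, D i (G.O i) := by
  classical
  obtain ⟨m, hm⟩ : ∃ m, (G.Z.filter fun c => x c ≠ G.O c).card = m := ⟨_, rfl⟩
  induction m using Nat.strong_induction_on generalizing x D δ with
  | _ m ih =>
  by_cases hfix : ∀ c ∈ G.Z, x c = G.O c
  · exact sum_le_index_of_fixed hn hG hD h0 hy hfix h fun c hc => (hδ c hc).imp_right And.left
  push Not at hfix
  obtain ⟨c, hc, hcx⟩ := hfix
  have hcx' := (hx c hc).resolve_left hcx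
  set x' := x * swap c (c + 1) with hx'
  have hxx : x' * swap c (c + 1) = x := by rw [hx', mul_assoc, swap_mul_self, mul_one]
  have e1 : x' c = G.O c := by rw [hx', mul_swap_left, hcx']
  have e2 : x' (c + 1) = x c := mul_swap_right _ _ _
  have e3 : ∀ i ∈ G.Z, i ≠ c → x' i = x i ∧ x' (i + 1) = x (i + 1) := by
    intro i hi hic
    exact ⟨mul_swap_of_ne x hic fun e => hG.add_one_notMem hn hc (e ▸ hi),
      mul_swap_of_ne x (fun e => hG.add_one_notMem hn hi (e ▸ hc))
        fun e => hic (add_right_cancel e)⟩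
  have hD' := isDomain_rect x' (ne_add_one hn c)
  rw [hxx] at hD'
  have hr := rect_nonneg x' c (c + 1)
  have hδc := (hδ c hc).resolve_right fun e => hcx e.2
  have key := ih (G.Z.filter fun i => x' i ≠ G.O i).card ?_ (hD'.add hD) (δ := Function.update δ c 1)
    (fun i j => add_nonneg (hr i j) (h0 i j)) ?_ ?_ ?_ rfl
  · have h1 := maslov_thin (G := G) hn x' c
    rw [hxx] at h1
    have h2 : ∑ i ∈ G.Z, Function.update δ c 1 i = ∑ i ∈ G.Z, δ i + 1 := by
      rw [← Finset.add_sum_erase _ _ hc, ← Finset.add_sum_erase _ δ hc, Function.update_self, hδc,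
        Finset.sum_congr rfl fun i hi => Function.update_of_ne (Finset.ne_of_mem_erase hi) 1 δ]
      ring
    simp only [Finset.sum_add_distrib] at key ⊢
    linarith
  · rw [← hm]
    refine Finset.card_lt_card ⟨fun i hi => ?_, fun hsub => ?_⟩
    · rw [Finset.mem_filter] at *
      have hic : i ≠ c := fun e => hi.2 (by rw [e, e1])
      exact ⟨hi.1, by rw [← (e3 i hi.1 hic).1]; exact hi.2⟩
    · exact (Finset.mem_filter.1 (hsub (Finset.mem_filter.2 ⟨hc, hcx⟩))).2 e1
  · intro i hi
    by_cases hic : i = c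
    · subst hic; exact .inl e1
    · rw [(e3 i hi hic).1, (e3 i hi hic).2]; exact hx i hi
  · intro i hi
    obtain ⟨ha, hb, hc', hd⟩ := h i hi
    refine ⟨by linarith [hr (i - 1) (G.O i)], ?_, by linarith [hr (i - 1) (G.O i - 1)],
      by linarith [hr i (G.O i - 1)]⟩
    by_cases hic : i = c
    · subst hic
      rw [Function.update_self, rect, arc_left (ne_add_one hn i), e1, e2, arc_left hcx.symm]
      linarith
    · rw [Function.update_of_ne hic]
      linarith [hr i (G.O i)]
  · intro i hi
    by_cases hic : i = c
    · subst hic; rw [Function.update_self]; exact .inr ⟨rfl, e1⟩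
    · rw [Function.update_of_ne hic, (e3 i hi hic).1]; exact hδ i hi

/-- The points of `x` on the vertical circles through the left and right edges of the square of
`O_c` are not corners of this square. -/
def IsFree {n : ℕ} [NeZero n] (G : MarkedGrid n) (x : Perm (Fin n)) (c : Fin n) : Prop :=
  c ∈ G.Z ∧ x c ≠ G.O c ∧ x (c + 1) ≠ G.O c

/-- A positive pair of negative index has a free destabilization point. -/
theorem Pair.exists_isFree (hn : 1 < n) (hG : G.IsSparse) {P : G.Pair} (hP : P.IsPositive)
    (hi : P.index < 0) : ∃ c, G.IsFree P.x c := by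
  by_contra hfree
  simp only [IsFree] at hfree
  push Not at hfree
  obtain ⟨D, f, h⟩ := P.isPositive_iff.1 hP
  -- The index of the pair is the right-hand side of this inequality minus the sum of `2 f + ε`,
  -- hence nonnegative.
  have key := sum_le_index hn hG h.dom h.nonneg P.y.2 (fun c hc => ?_) (f := f) (e := P.eps)
    (δ := fun _ => 0) ?_ (fun c _ => .inl rfl)
  · rw [Pair.index_eq] at hi
    have h1 : ∑ i, f i = ∑ c ∈ G.Z, f c :=
      (Finset.sum_subset (Finset.subset_univ _) fun i _ hi => h.fake i hi).symm
    simp only [h.exp, Finset.sum_sub_distrib] at hi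
    simp only [Finset.sum_add_distrib, ← Finset.mul_sum, Finset.sum_const_zero] at key
    linarith
  · by_cases hc' : P.x c = G.O c
    · exact .inl hc'
    · exact .inr (hfree c hc hc')
  · simpa only [add_zero] using h.le

/-- The pair obtained by exchanging the points on two adjacent vertical circles. -/
def Pair.flip (P : G.Pair) (c : Fin n) : G.Pair :=
  ⟨P.x * swap c (c + 1), P.y, P.ε, P.N⟩

theorem Pair.flip_flip (P : G.Pair) (c : Fin n) : (P.flip c).flip c = P := by
  simp only [Pair.flip, mul_assoc, swap_mul_self, mul_one]

/-- Going up from the destabilization point, the circle `c` is met first by `x c`. -/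
def IsTop {n : ℕ} [NeZero n] (G : MarkedGrid n) (x : Perm (Fin n)) (c : Fin n) : Prop :=
  Btw (G.O c) (x (c + 1)) (x c)

/-- Removing the thin rectangle could make multiplicities negative. First `t` copies of the column
annulus are added and `f c` is raised by `t`: the exponents and the inequalities on the right of the
point are unaffected, and only those on the left limit `t`. With `t` maximal, column `c` is at least
one along the rectangle. -/
theorem Pair.flip_isPositive (hn : 1 < n) (hG : G.IsSparse) {P : G.Pair} (hP : P.IsPositive)
    {c : Fin n} (hc : G.IsFree P.x c) (ht : G.IsTop P.x c) : (P.flip c).IsPositive := by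
  rw [Pair.isPositive_iff] at *
  obtain ⟨D, f, h⟩ := hP
  obtain ⟨hcZ, hc1, hc2⟩ := hc
  obtain ⟨ha, hb, hc', hd⟩ := h.le c hcZ
  -- The smaller slack of the two left inequalities, so that one of them becomes an equality.
  obtain ⟨t, h0, h1, h2, h3⟩ : ∃ t, 0 ≤ t ∧ f c + t ≤ D (c - 1) (G.O c) ∧
      f c + t + P.eps c - 1 ≤ D (c - 1) (G.O c - 1) ∧
      (f c + t = D (c - 1) (G.O c) ∨ f c + t + P.eps c - 1 = D (c - 1) (G.O c - 1)) := by
    rcases le_total (D (c - 1) (G.O c) - f c) (D (c - 1) (G.O c - 1) + 1 - P.eps c - f c) with e | e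
    · exact ⟨D (c - 1) (G.O c) - f c, by linarith, by linarith, by linarith, .inl (by ring)⟩
    · exact ⟨D (c - 1) (G.O c - 1) + 1 - P.eps c - f c, by linarith, by linarith, by linarith,
        .inr (by ring)⟩
  have hO : arc (P.x c) (P.x (c + 1)) (G.O c) = 0 := if_neg fun hO => by
    rcases hO.eq_or_btw with e | e
    · exact hc1 e.symm
    · exact ht.rotate.rotate.asymm e
  have hO' : arc (P.x c) (P.x (c + 1)) (G.O c - 1) = 0 := by
    rw [arc_sub_one_of_ne hc1.symm hc2.symm, hO]
  have hcc := ne_add_one hn c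
  have hsub : ∀ i ∈ G.Z, i - 1 ≠ c := fun i hi e => hG.sub_one_notMem hn hi (e ▸ hcZ)
  refine ⟨fun i j => (D i j + if i = c then t else 0) - rect P.x c (c + 1) i j,
    fun i => f i + if i = c then t else 0, ?_, ?_, ?_, ?_, ?_⟩
  · exact (h.dom.add (IsDomain.col P.y.1 fun i => if i = c then t else 0)).sub
      (isDomain_rect P.x hcc)
  · intro i j
    rw [rect, arc_add_one hn]
    by_cases hi : i = c
    · subst hi
      simp only [if_true, one_mul]
      by_cases hj : InArc (P.x i) (P.x (i + 1)) j
      -- The jump of `D` across the circle at row `j` is compared with the jump just above and just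
      -- below the point; the first is used when the upper left inequality is sharp, the second when
      -- the lower left one is.
      · have e1 := h.dom.sub_add_arc i j (G.O i)
        have e2 := h.dom.sub_add_arc i j (G.O i - 1)
        rw [P.y.2 i hcZ] at e1 e2
        have e3 : arc (G.O i) (P.x i) j = 0 := if_neg fun hj' => by
          exact ht.inArc_disj j hj' hj
        rw [arc_left hc1.symm, e3] at e1
        rw [arc_sub_one, arc_left hc1.symm, if_neg hc1.symm, if_pos rfl, e3] at e2
        rw [arc, if_pos hj]
        have := h.nonneg (i - 1) j
        rcases h3 with h3 | h3 <;> linarith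
      · rw [arc, if_neg hj]
        linarith [h.nonneg i j]
    · simp only [if_neg hi]
      linarith [h.nonneg i j]
  · intro i hi
    have : i ≠ c := fun e => hi (e ▸ hcZ)
    rw [h.fake i hi, if_neg this, add_zero]
  · intro i hi
    have hp : (P.flip c).eps i = P.eps i := rfl
    simp only [rect, arc_add_one hn, hp, if_neg (hsub i hi)]
    by_cases hic : i = c
    · subst hic
      simp only [if_true, hO, hO']
      refine ⟨?_, ?_, ?_, ?_⟩ <;> linarith
    · simp only [if_neg hic]
      simpa using h.le i hi
  · intro i
    have hp : ((P.flip c).N i : ℤ) = P.N i := rfl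
    rw [hp, h.exp, rect, arc_add_one hn]
    by_cases hic : i = c
    · subst hic
      simp only [if_true, hO]
      ring
    · simp only [if_neg hic]
      ring

end MarkedGrid

/-! ### The weight of a pair -/

namespace MarkedGrid
open Equiv
variable {n : ℕ} [NeZero n] {G : MarkedGrid n}

/-- A function on matchings whose differences compute the weights of domains. -/
def potential {n : ℕ} (w : Fin n → Fin n → ℤ) (x : Perm (Fin n)) : ℤ :=
  ∑ i, ∑ j, w i j * ∑ a, if a ≤ i ∧ x a ≤ j then 1 else 0

/-- Weights with vanishing row and column sums do not see annuli, so the weight of any domain equals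
that of the planar one, which is a difference of two endpoint terms. -/
theorem IsDomain.potential_sub {w : Fin n → Fin n → ℤ} (hr : ∀ j, ∑ i, w i j = 0)
    (hc : ∀ i, ∑ j, w i j = 0) {x y : Perm (Fin n)} {D : Fin n → Fin n → ℤ} (h : IsDomain x y D) :
    potential w x - potential w y = ∑ i, ∑ j, w i j * D i j := by
  obtain ⟨s, r, hD⟩ := h.eq_planar_add
  have h1 : ∑ i, ∑ j, w i j * s i = 0 :=
    Finset.sum_eq_zero fun i _ => by rw [← Finset.sum_mul, hc, zero_mul]
  have h2 : ∑ i, ∑ j, w i j * r j = 0 := by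
    rw [Finset.sum_comm]
    exact Finset.sum_eq_zero fun j _ => by rw [← Finset.sum_mul, hr, zero_mul]
  simp only [hD, mul_add, Finset.sum_add_distrib, h1, h2, add_zero, planar,
    Finset.sum_sub_distrib, mul_sub, potential]

/-- The indicator function of the two rows which meet a destabilization point. -/
def rowIndicator (G : MarkedGrid n) (c j : Fin n) : ℤ :=
  (if j = G.O c then 1 else 0) + if j = G.O c - 1 then 1 else 0

theorem rowIndicator_nonneg (c j : Fin n) : 0 ≤ G.rowIndicator c j := by
  unfold rowIndicator
  split_ifs <;> norm_num

theorem sum_rowIndicator (c : Fin n) : ∑ j, G.rowIndicator c j = 2 := by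
  simp [rowIndicator, Finset.sum_add_distrib]

theorem IsSparse.sum_rowIndicator_le (hn : 1 < n) (hG : G.IsSparse) (j : Fin n) :
    ∑ c ∈ G.Z, G.rowIndicator c j ≤ 1 := by
  classical
  by_cases h : ∃ c ∈ G.Z, G.rowIndicator c j ≠ 0
  · obtain ⟨c, hc, h⟩ := h
    rw [Finset.sum_eq_single_of_mem c hc]
    · have h1 : G.O c - 1 ≠ G.O c := fun e => ne_add_one hn (G.O c - 1) (by
        rw [sub_add_cancel, e])
      by_cases e : j = G.O c
      · simp [rowIndicator, e, h1.symm]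
      · simp only [rowIndicator, e, if_false]
        split_ifs <;> norm_num
    · intro i hi hic
      by_contra h'
      have hO : G.O i ≠ G.O c := fun e => hic (G.O.injective e)
      have e1 := (hG i hi c hc hic).2
      have e2 := (hG c hc i hi hic.symm).2
      have h3 : ∀ c, G.rowIndicator c j ≠ 0 → j = G.O c ∨ j + 1 = G.O c := by
        intro c hc
        by_contra h4
        rw [not_or, ← eq_sub_iff_add_eq] at h4
        exact hc (by simp [rowIndicator, h4])
      rcases h3 c h with a | a <;> rcases h3 i h' with b | b
      · exact hO (b.symm.trans a)
      · exact e2 (by rw [← a, b])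
      · exact e1 (by rw [← b, a])
      · exact hO (b.symm.trans a)
  · push Not at h
    rw [Finset.sum_eq_zero h]
    exact zero_le_one

theorem IsSparse.card_lt (hn : 1 < n) (hG : G.IsSparse) : (0 : ℤ) < n - G.Z.card := by
  have h : G.Z.card < Fintype.card (Fin n) := by
    rw [Finset.card_lt_iff_ne_univ]
    intro h
    exact hG.add_one_notMem hn (c := 0) (h ▸ Finset.mem_univ _) (h ▸ Finset.mem_univ _)
  rw [Fintype.card_fin] at h
  omega

/-- Nonnegative weights of the squares with constant row and column sums; the weight of a square
vanishes only in a column of a marked `O` and away from its destabilization point. -/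
def squareWeight (G : MarkedGrid n) (i j : Fin n) : ℤ :=
  if i ∈ G.Z then (n - G.Z.card) * G.rowIndicator i j else 2 - ∑ c ∈ G.Z, G.rowIndicator c j

theorem sum_squareWeight_col (i : Fin n) : ∑ j, G.squareWeight i j = 2 * (n - G.Z.card) := by
  unfold squareWeight
  split_ifs with h
  · rw [← Finset.mul_sum, sum_rowIndicator, mul_comm]
  · rw [Finset.sum_sub_distrib, Finset.sum_comm, Finset.sum_congr rfl fun c _ => sum_rowIndicator c]
    simp
    ring

theorem sum_squareWeight_row (j : Fin n) : ∑ i, G.squareWeight i j = 2 * (n - G.Z.card) := by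
  classical
  have h : ((Finset.univ \ G.Z).card : ℤ) = n - G.Z.card := by
    rw [← Finset.compl_eq_univ_sdiff, Finset.card_compl, Fintype.card_fin,
      Nat.cast_sub (by simpa using Finset.card_le_univ G.Z)]
  have h1 : ∑ i ∈ G.Z, G.squareWeight i j = ∑ i ∈ G.Z, (n - G.Z.card) * G.rowIndicator i j :=
    Finset.sum_congr rfl fun i hi => if_pos hi
  have h2 : ∑ i ∈ Finset.univ \ G.Z, G.squareWeight i j =
      ∑ i ∈ Finset.univ \ G.Z, (2 - ∑ c ∈ G.Z, G.rowIndicator c j) :=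
    Finset.sum_congr rfl fun i hi => if_neg (Finset.mem_sdiff.1 hi).2
  rw [← Finset.sum_sdiff (Finset.subset_univ G.Z), h1, h2, ← Finset.mul_sum, Finset.sum_const,
    nsmul_eq_mul, h]
  ring

theorem squareWeight_of_notMem (hn : 1 < n) (hG : G.IsSparse) {i : Fin n} (hi : i ∉ G.Z)
    (j : Fin n) : 0 < G.squareWeight i j := by
  rw [squareWeight, if_neg hi]
  linarith [hG.sum_rowIndicator_le hn j]

theorem squareWeight_nonneg (hn : 1 < n) (hG : G.IsSparse) (i j : Fin n) :
    0 ≤ G.squareWeight i j := by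
  by_cases hi : i ∈ G.Z
  · rw [squareWeight, if_pos hi]
    exact mul_nonneg (hG.card_lt hn).le (rowIndicator_nonneg i j)
  · exact (squareWeight_of_notMem hn hG hi j).le

/-- The weights of the squares, corrected at the markings to have vanishing row and column sums. -/
def balancedWeight (G : MarkedGrid n) (i j : Fin n) : ℤ :=
  G.squareWeight i j - if j = G.O i then 2 * (n - G.Z.card : ℤ) else 0

theorem IsDomain.potential_balancedWeight {x y : Perm (Fin n)} {D : Fin n → Fin n → ℤ}
    (h : IsDomain x y D) : potential G.balancedWeight x - potential G.balancedWeight y =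
      ∑ i, ∑ j, G.squareWeight i j * D i j - 2 * (n - G.Z.card) * ∑ i, D i (G.O i) := by
  rw [h.potential_sub]
  · simp only [balancedWeight, sub_mul, Finset.sum_sub_distrib, ite_mul, zero_mul,
      Finset.sum_ite_eq', Finset.mem_univ, if_true]
    rw [Finset.mul_sum]
  · intro j
    have : ∀ i, j = G.O i ↔ i = G.O.symm j := fun i => by
      rw [Equiv.eq_symm_apply, eq_comm]
    simp only [balancedWeight, Finset.sum_sub_distrib, sum_squareWeight_row, this,
      Finset.sum_ite_eq', Finset.mem_univ, if_true]
    ring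
  · intro i
    simp only [balancedWeight, Finset.sum_sub_distrib, sum_squareWeight_col,
      Finset.sum_ite_eq', Finset.mem_univ, if_true]
    ring

/-- The weight of a pair. It is the total weight of a domain of the pair, with a correction for the
fake multiplicities. -/
def Pair.weight (P : G.Pair) : ℤ :=
  potential G.balancedWeight P.x - potential G.balancedWeight P.y.1 +
    2 * (n - G.Z.card) * ∑ i, (P.N i : ℤ)

/-- The total weight of the squares of a rectangle. -/
def rectWeight (G : MarkedGrid n) (x : Perm (Fin n)) (a b : Fin n) : ℤ :=
  ∑ i, ∑ j, G.squareWeight i j * rect x a b i j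

theorem weight_pre (P : G.Pair) (x' : Perm (Fin n)) (r : Fin n × Fin n) (hr : r.1 ≠ r.2)
    (hx : P.x = x' * swap r.1 r.2) :
    Pair.weight ⟨x', P.y, P.ε, P.N + G.rectO ∅ x' r⟩ = P.weight + G.rectWeight x' r.1 r.2 := by
  have h := (isDomain_rect x' hr).potential_balancedWeight (G := G)
  rw [← hx] at h
  have h1 : ∀ i, (G.rectO ∅ x' r i : ℤ) = rect x' r.1 r.2 i (G.O i) := fun i => by
    rw [rectO_eq]; simp
  simp only [Pair.weight, rectWeight, Pi.add_apply, Nat.cast_add, Finset.sum_add_distrib, h1]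
  linarith

theorem weight_post (P : G.Pair) (y' : G.DestabState) (r : Fin n × Fin n) (hr : r.1 ≠ r.2)
    (hy : y'.1 = P.y.1 * swap r.1 r.2) :
    Pair.weight ⟨P.x, y', P.ε, P.N + G.rectO G.Z P.y.1 r⟩ = P.weight +
      G.rectWeight P.y.1 r.1 r.2 -
      2 * (n - G.Z.card) * ∑ i ∈ G.Z, rect P.y.1 r.1 r.2 i (G.O i) := by
  classical
  have h := (isDomain_rect P.y.1 hr).potential_balancedWeight (G := G)
  rw [← hy] at h
  have h1 : ∑ i, (G.rectO G.Z P.y.1 r i : ℤ) = ∑ i, rect P.y.1 r.1 r.2 i (G.O i) -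
      ∑ i ∈ G.Z, rect P.y.1 r.1 r.2 i (G.O i) := by
    rw [eq_sub_iff_add_eq, ← Finset.sum_sdiff (Finset.subset_univ G.Z)]
    conv_rhs => rw [← Finset.sum_sdiff (Finset.subset_univ G.Z)]
    rw [Finset.sum_congr (rfl : G.Z = G.Z) fun i hi => (rectO_eq G G.Z P.y.1 r i).trans
        (if_neg (not_not.2 hi)),
      Finset.sum_congr rfl fun i hi => (rectO_eq G G.Z P.y.1 r i).trans
        (if_pos (Finset.mem_sdiff.1 hi).2)]
    simp
  simp only [Pair.weight, rectWeight, Pi.add_apply, Nat.cast_add, Finset.sum_add_distrib, h1] at h ⊢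
  linarith

theorem rectWeight_term_nonneg (hn : 1 < n) (hG : G.IsSparse) (x : Perm (Fin n)) (a b i j : Fin n) :
    0 ≤ G.squareWeight i j * rect x a b i j :=
  mul_nonneg (squareWeight_nonneg hn hG i j) (rect_nonneg x a b i j)

theorem squareWeight_mul_le_rectWeight (hn : 1 < n) (hG : G.IsSparse) (x : Perm (Fin n))
    (a b i j : Fin n) : G.squareWeight i j * rect x a b i j ≤ G.rectWeight x a b := by
  refine (Finset.single_le_sum (f := fun j => G.squareWeight i j * rect x a b i j)
    (fun j _ => rectWeight_term_nonneg hn hG x a b i j) (Finset.mem_univ j)).trans ?_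
  exact Finset.single_le_sum (f := fun i => ∑ j, G.squareWeight i j * rect x a b i j)
    (fun i _ => Finset.sum_nonneg fun j _ => rectWeight_term_nonneg hn hG x a b i j)
    (Finset.mem_univ i)

/-- The rectangle crosses the marked column `i` either in both rows meeting the destabilization
point or in neither. Their weights are `n - k` each, where `k` is the number of marked `O`'s, so
they balance the correction `2 (n - k)` for the uncounted `O`. Strictness comes from the unmarked
column `a`. -/
theorem lt_rectWeight_of_marked (hn : 1 < n) (hG : G.IsSparse) {y : Perm (Fin n)}
    (hy : ∀ c ∈ G.Z, y c = G.O c) {a b : Fin n} (h : IsEmptyRect G.Z y a b) :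
    2 * (n - G.Z.card) * ∑ i ∈ G.Z, rect y a b i (G.O i) < G.rectWeight y a b := by
  classical
  have hy' := y.injective.ne h.1
  rw [rectWeight, ← Finset.sum_sdiff (Finset.subset_univ G.Z), Finset.mul_sum]
  refine lt_add_of_pos_of_le ?_ (Finset.sum_le_sum fun i hi => ?_)
  · refine Finset.sum_pos' (fun i _ => Finset.sum_nonneg fun j _ =>
      rectWeight_term_nonneg hn hG y a b i j) ⟨a, by simp [h.2.1], ?_⟩
    refine Finset.sum_pos' (fun j _ => rectWeight_term_nonneg hn hG y a b a j)
      ⟨y a, Finset.mem_univ _, ?_⟩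
    rw [rect, arc_left h.1, arc_left hy', mul_one, mul_one]
    exact squareWeight_of_notMem hn hG h.2.1 _
  · have ha : i ≠ a := fun e => h.2.1 (e ▸ hi)
    have hb : i ≠ b := fun e => h.2.2.1 (e ▸ hi)
    have ha' := y.injective.ne ha
    have hb' := y.injective.ne hb
    rw [hy i hi] at ha' hb'
    simp only [squareWeight, if_pos hi, rowIndicator, mul_assoc, add_mul, ite_mul, one_mul,
      zero_mul, ← Finset.mul_sum, Finset.sum_add_distrib, Finset.sum_ite_eq', Finset.mem_univ,
      if_true, rect, arc_sub_one_of_ne ha' hb']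
    linarith

/-- The terms of the differential have larger weight, except for thin rectangles which avoid the
rows meeting the destabilization point in their column. -/
theorem Pair.Arrow.weight_lt (hn : 1 < n) (hG : G.IsSparse) {P Q : G.Pair} (h : P.Arrow Q) :
    P.weight < Q.weight ∨ ∃ c, G.IsFree P.x c ∧ ¬ G.IsTop P.x c ∧ Q = P.flip c := by
  have hκ := hG.card_lt hn
  cases h with
  | pre x' r h hx =>
    rw [weight_pre P x' r h.1 hx]
    obtain ⟨a, b⟩ := r
    dsimp only at *
    -- A rectangle of weight zero lies in marked columns. By sparseness it has width one, and it
    -- avoids the two weighted rows of its column.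
    by_cases hw : 0 < G.rectWeight x' a b
    · exact .inl (by linarith)
    right
    have hab := h.1
    have hx' := x'.injective.ne hab
    have h0 : ∀ i j, G.squareWeight i j * rect x' a b i j ≤ 0 := fun i j =>
      (squareWeight_mul_le_rectWeight hn hG x' a b i j).trans (not_lt.1 hw)
    have hZ : ∀ i, InArc a b i → i ∈ G.Z := by
      intro i hi
      by_contra hiZ
      have h1 := squareWeight_of_notMem hn hG hiZ (x' a)
      have h2 := h0 i (x' a)
      rw [rect, arc, if_pos hi, arc_left hx', mul_one, mul_one] at h2
      linarith
    have ha := hZ a (inArc_left hab)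
    obtain rfl : b = a + 1 := by
      by_contra hb
      refine hG.add_one_notMem hn ha (hZ _ ?_)
      have h1 := arc_sub_one a b (a + 1)
      rw [add_sub_cancel_right, arc_left hab, if_neg (Ne.symm hb), if_neg (ne_add_one hn a).symm]
        at h1
      by_contra h2
      rw [arc, if_neg h2] at h1
      norm_num at h1
    have hrow : ∀ j, 0 < G.rowIndicator a j → arc (x' a) (x' (a + 1)) j = 0 := by
      intro j hj
      have h2 := h0 a j
      rw [rect, arc_left hab, squareWeight, if_pos ha, one_mul] at h2
      have h3 := arc_nonneg (x' a) (x' (a + 1)) j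
      by_contra h4
      have h5 := mul_pos (mul_pos hκ hj) (lt_of_le_of_ne h3 (Ne.symm h4))
      linarith
    have r1 : 0 < G.rowIndicator a (G.O a) := by
      rw [rowIndicator, if_pos rfl]; split_ifs <;> norm_num
    have r2 : 0 < G.rowIndicator a (G.O a - 1) := by
      rw [rowIndicator, if_pos (rfl : G.O a - 1 = _)]; split_ifs <;> norm_num
    have z1 := hrow _ r1
    have z2 := hrow _ r2
    have f1 : x' a ≠ G.O a := fun e => by
      rw [← e, arc_left hx'] at z1
      exact one_ne_zero z1
    -- Arcs are half-open, so a rectangle ending at the circle `O a` would cover the row below it;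
    -- this is excluded only because that row also carries weight.
    have f2 : x' (a + 1) ≠ G.O a := fun e => by
      rw [← e, arc_sub_one, arc_right, if_pos rfl, if_neg hx'.symm] at z2
      norm_num at z2
    refine ⟨a, ⟨ha, by rwa [hx, mul_swap_left], by rwa [hx, mul_swap_right]⟩, ?_, ?_⟩
    · rw [IsTop, hx, mul_swap_left, mul_swap_right]
      intro ht
      rw [arc, if_pos ht.rotate.rotate.inArc] at z1
      exact one_ne_zero z1
    · have : G.rectO ∅ x' (a, a + 1) = 0 := by
        funext i
        have h1 := rectO_eq G ∅ x' (a, a + 1) i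
        simp only [Finset.notMem_empty, not_false_eq_true, if_true, rect, arc_add_one hn] at h1
        by_cases hi : i = a
        · subst hi
          rw [z1, mul_zero] at h1
          exact_mod_cast h1
        · rw [if_neg hi, zero_mul] at h1
          exact_mod_cast h1
      rw [this, add_zero, Pair.flip, hx, mul_assoc, swap_mul_self, mul_one]
  | post y' r h hy =>
    rw [weight_post P y' r h.1 hy]
    have := lt_rectWeight_of_marked hn hG P.y.2 h
    exact .inl (by linarith)
  | marked c h =>
    left
    simp only [Pair.weight, Pi.add_apply, Nat.cast_add, Finset.sum_add_distrib, ← Nat.cast_sum]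
    simp
    linarith
  | below c h =>
    left
    simp only [Pair.weight, Pi.add_apply, Nat.cast_add, Finset.sum_add_distrib, ← Nat.cast_sum]
    simp
    linarith

/-- The thin rectangle at a free destabilization point whose circle is met last by `x c`. -/
theorem arc_of_not_isTop {x : Perm (Fin n)} {c : Fin n} (hn : 1 < n) (hc : G.IsFree x c)
    (ht : ¬ G.IsTop x c) : Btw (G.O c) (x c) (x (c + 1)) :=
  (btw_or hc.2.1.symm hc.2.2.symm (x.injective.ne (ne_add_one hn c))).resolve_right ht

theorem rectO_thin (hn : 1 < n) {x : Perm (Fin n)} {c : Fin n} (hc : G.IsFree x c)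
    (ht : ¬ G.IsTop x c) : G.rectO ∅ (x * swap c (c + 1)) (c, c + 1) = 0 := by
  have hb := arc_of_not_isTop hn hc ht
  funext i
  rw [rectO, Pi.zero_apply, if_neg]
  rintro ⟨-, h1, h2⟩
  dsimp only at h1 h2
  rw [mul_swap_left, mul_swap_right] at h2
  have h3 := arc_add_one hn c i
  rw [arc, if_pos h1] at h3
  obtain rfl : i = c := by by_contra h4; simp [h4] at h3
  rcases h2.eq_or_btw with e | e
  · exact hc.2.2 e.symm
  · exact hb.rotate.rotate.asymm e

theorem weight_flip (hn : 1 < n) {P : G.Pair} {c : Fin n} (hc : G.IsFree P.x c)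
    (ht : ¬ G.IsTop P.x c) : (P.flip c).weight = P.weight := by
  have hcc := ne_add_one hn c
  have hb := arc_of_not_isTop hn hc ht
  have h := weight_pre P (P.x * swap c (c + 1)) (c, c + 1) hcc
    (by rw [mul_assoc, swap_mul_self, mul_one])
  rw [rectO_thin hn hc ht, add_zero] at h
  rw [Pair.flip, h, add_eq_left]
  have hO : arc (P.x (c + 1)) (P.x c) (G.O c) = 0 := if_neg fun h2 => by
    rcases h2.eq_or_btw with e | e
    · exact hc.2.2 e.symm
    · exact hb.rotate.rotate.asymm e
  have hO' : arc (P.x (c + 1)) (P.x c) (G.O c - 1) = 0 := by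
    rw [arc_sub_one_of_ne hc.2.2.symm hc.2.1.symm, hO]
  refine Finset.sum_eq_zero fun i _ => Finset.sum_eq_zero fun j _ => ?_
  dsimp only
  rw [rect, arc_add_one hn, mul_swap_left, mul_swap_right]
  by_cases hi : i = c
  · subst hi
    rw [squareWeight, if_pos hc.1, if_pos rfl, one_mul, rowIndicator]
    split_ifs with h1 h2 h2
    · rw [h1, hO, mul_zero]
    · rw [h1, hO, mul_zero]
    · rw [h2, hO', mul_zero]
    · ring
  · rw [if_neg hi, zero_mul, mul_zero]

/-- The two matchings are joined by two possible rectangles. The thin one is empty and carries no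
`O`; the one over the complementary columns has a positive power of a variable and ends at another
pair. All other terms of the differential keep `P.x`. -/
theorem diffPair_flip (hn : 1 < n) {P : G.Pair} {c : Fin n} (hc : G.IsFree P.x c)
    (ht : ¬ G.IsTop P.x c) : G.diffPair P (P.flip c) = 1 := by
  have hcc := ne_add_one hn c
  have hb := arc_of_not_isTop hn hc ht
  have hne : P.x ≠ P.x * swap c (c + 1) := fun e =>
    hcc (by simpa using congrArg (fun z => P.x.symm (z (c + 1))) e)
  have hself : P.x = P.x * swap c (c + 1) * swap c (c + 1) := by
    rw [mul_assoc, swap_mul_self, mul_one]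
  have hx0 : ∀ {Q : G.Pair}, Q.x = P.x → Finsupp.single Q (1 : ZMod 2) (P.flip c) = 0 := by
    intro Q hQ
    exact Finsupp.single_eq_of_ne fun e => hne (hQ.symm.trans (congrArg Pair.x e).symm)
  rw [diffPair, Finsupp.add_apply, Finsupp.add_apply, Finsupp.finsetSum_apply,
    Finset.sum_eq_single (P.x * swap c (c + 1)), Finsupp.finsetSum_apply,
    Finset.sum_eq_single (c, c + 1), Finsupp.finsetSum_apply, Finset.sum_eq_zero,
    Finsupp.finsetSum_apply, Finset.sum_eq_zero]
  · rw [rectO_thin hn hc ht, add_zero, add_zero, add_zero]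
    exact Finsupp.single_eq_same
  · intro i _
    split_ifs
    · exact (Finsupp.sub_apply _ _ _).trans (by rw [hx0 (by rfl), hx0 (by rfl), sub_zero])
    · rfl
  · intro y' _
    rw [Finsupp.finsetSum_apply]
    exact Finset.sum_eq_zero fun r _ => hx0 rfl
  · intro r hr hrc
    rw [mem_emptyRect] at hr
    obtain ⟨a, b⟩ := r
    obtain ⟨hr, hx⟩ := hr
    dsimp only at hr hx
    have hs : swap c (c + 1) = swap a b := by
      have := hself.symm.trans hx
      exact mul_left_cancel this
    have hca : c = a ∧ c + 1 = b ∨ c = b ∧ c + 1 = a := by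
      have h1 : c = a ∨ c = b := by
        by_contra h2
        rw [not_or] at h2
        have h3 := swap_apply_of_ne_of_ne h2.1 h2.2
        rw [← hs, swap_apply_left] at h3
        exact hcc h3.symm
      rcases h1 with rfl | rfl
      · refine .inl ⟨rfl, ?_⟩
        have h3 := swap_apply_left c (c + 1)
        rwa [hs, swap_apply_left, eq_comm] at h3
      · refine .inr ⟨rfl, ?_⟩
        have h3 := swap_apply_left c (c + 1)
        rwa [hs, swap_apply_right, eq_comm] at h3
    rcases hca with ⟨rfl, rfl⟩ | ⟨rfl, rfl⟩
    · exact (hrc rfl).elim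
    refine Finsupp.single_eq_of_ne fun e => ?_
    have h1 := congrArg (fun Q : G.Pair => Q.N (G.O.symm (G.O c - 1))) e
    -- The wide rectangle covers the row below the destabilization point, and the `O` of that row
    -- lies outside column `c`.
    have h2 : G.rectO ∅ (P.x * swap c (c + 1)) (c + 1, c) (G.O.symm (G.O c - 1)) = 1 := by
      refine if_pos ⟨Finset.notMem_empty _, ?_, ?_⟩
      · dsimp only
        rw [InArc.not_swap hcc.symm]
        intro h3
        have h4 := arc_add_one hn c (G.O.symm (G.O c - 1))
        rw [arc, if_pos h3] at h4
        have h5 : G.O.symm (G.O c - 1) = c := by by_contra h5; simp [h5] at h4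
        rw [Equiv.symm_apply_eq] at h5
        exact ne_add_one hn (G.O c - 1) (by rw [sub_add_cancel, h5])
      · dsimp only
        rw [mul_swap_left, mul_swap_right, apply_symm_apply]
        have h3 := arc_sub_one_of_ne hc.2.1.symm hc.2.2.symm
        have h4 : InArc (P.x c) (P.x (c + 1)) (G.O c) := hb.rotate.rotate.inArc
        by_contra h5
        rw [arc, arc, if_pos h4, if_neg h5] at h3
        exact zero_ne_one h3
    simp only [Pair.flip, Pi.add_apply, h2] at h1
    omega
  · intro h
    refine (h (mem_emptyRect.2 ⟨⟨hcc, by simp, by simp, fun i _ hi => ?_⟩, hself⟩)).elim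
    have h3 := arc_add_one hn c i
    rw [arc, if_pos hi.1.2, if_neg hi.1.1] at h3
    exact one_ne_zero h3
  · intro x' _ hx'
    rw [Finsupp.finsetSum_apply]
    exact Finset.sum_eq_zero fun r _ =>
      Finsupp.single_eq_of_ne fun e => hx' (congrArg Pair.x e).symm
  · intro h
    exact (h (Finset.mem_univ _)).elim

end MarkedGrid

/-! ### The matching and the vanishing of cohomology -/

namespace MarkedGrid
open Equiv
variable {n : ℕ} [NeZero n] {G : MarkedGrid n}

theorem flip_apply_of_ne (hn : 1 < n) (hG : G.IsSparse) (x : Perm (Fin n)) {c i : Fin n}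
    (hc : c ∈ G.Z) (hi : i ∈ G.Z) (hic : i ≠ c) :
    (x * swap c (c + 1)) i = x i ∧ (x * swap c (c + 1)) (i + 1) = x (i + 1) :=
  ⟨mul_swap_of_ne x hic fun e => hG.add_one_notMem hn hc (e ▸ hi),
    mul_swap_of_ne x (fun e => hG.add_one_notMem hn hi (e ▸ hc)) fun e => hic (add_right_cancel e)⟩

theorem isFree_flip (hn : 1 < n) (hG : G.IsSparse) (P : G.Pair) {c : Fin n} (hc : c ∈ G.Z)
    (i : Fin n) : G.IsFree (P.flip c).x i ↔ G.IsFree P.x i := by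
  refine and_congr_right fun hi => ?_
  by_cases hic : i = c
  · subst hic
    rw [Pair.flip, mul_swap_left, mul_swap_right, and_comm]
  · have h := flip_apply_of_ne hn hG P.x hc hi hic
    rw [Pair.flip, h.1, h.2]

theorem isTop_flip_of_ne (hn : 1 < n) (hG : G.IsSparse) (P : G.Pair) {c i : Fin n}
    (hc : c ∈ G.Z) (hi : i ∈ G.Z) (hic : i ≠ c) : G.IsTop (P.flip c).x i ↔ G.IsTop P.x i := by
  have h := flip_apply_of_ne hn hG P.x hc hi hic
  rw [Pair.flip, IsTop, IsTop, h.1, h.2]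

theorem isTop_flip (hn : 1 < n) {P : G.Pair} {c : Fin n} (hc : G.IsFree P.x c) :
    G.IsTop (P.flip c).x c ↔ ¬ G.IsTop P.x c := by
  rw [Pair.flip, IsTop, mul_swap_left, mul_swap_right]
  exact ⟨fun h h' => h.not_swap h', fun h => arc_of_not_isTop hn hc h⟩

/-- A choice of a free destabilization point. -/
noncomputable def pivot (G : MarkedGrid n) (x : Perm (Fin n)) : Fin n :=
  Classical.epsilon (G.IsFree x)

theorem isFree_pivot {x : Perm (Fin n)} (h : ∃ c, G.IsFree x c) : G.IsFree x (G.pivot x) :=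
  Classical.epsilon_spec h

/-- The pivot depends on `x` only through its set of free points, which no flip at a marked column
changes. Matched pairs therefore choose the same point. -/
theorem pivot_flip (hn : 1 < n) (hG : G.IsSparse) (P : G.Pair) {c : Fin n} (hc : c ∈ G.Z) :
    G.pivot (P.flip c).x = G.pivot P.x := by
  rw [pivot, pivot, show G.IsFree (P.flip c).x = G.IsFree P.x from
    funext fun i => propext (isFree_flip hn hG P hc i)]

/-- The positive pairs of index `d`. -/
def positivePairs (G : MarkedGrid n) (d : ℤ) : Set G.Pair := {P | P.IsPositive ∧ P.index = d}

/-- The positive pairs of index `d` which are not matched with a pair of lower index. -/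
def upperPairs (G : MarkedGrid n) (d : ℤ) : Set G.Pair :=
  {P | P ∈ G.positivePairs d ∧ ¬ G.IsTop P.x (G.pivot P.x)}

theorem exists_isFree_of_mem (hn : 1 < n) (hG : G.IsSparse) {d : ℤ} (hd : d < 0) {P : G.Pair}
    (hP : P ∈ G.positivePairs d) : ∃ c, G.IsFree P.x c :=
  Pair.exists_isFree hn hG hP.1 (hP.2.trans_lt hd)

theorem diff_single (P : G.Pair) : G.diff (Finsupp.single P 1) = G.diffPair P := by
  simp [diff]

theorem mem_support_diffPair_flip (hn : 1 < n) {P : G.Pair} {c : Fin n} (hc : G.IsFree P.x c)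
    (ht : ¬ G.IsTop P.x c) : P.flip c ∈ (G.diffPair P).support := by
  rw [Finsupp.mem_support_iff, diffPair_flip hn hc ht]
  exact one_ne_zero

/-- Modulo coboundaries, every positive pair of negative index is a combination of upper ones. -/
theorem single_mem_map_sup (hn : 1 < n) (hG : G.IsSparse) {d : ℤ} (hd : d < 0) (m : ℕ) (b : ℤ)
    (hb : ∀ P ∈ G.positivePairs d, P.weight ≤ b) (P : G.Pair) (hP : P ∈ G.positivePairs d)
    (hm : b - P.weight < m) : Finsupp.single P (1 : ZMod 2) ∈
      (G.CP (d - 1)).map G.diff ⊔ Finsupp.supported (ZMod 2) (ZMod 2) (G.upperPairs d) := by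
  classical
  induction m generalizing P with
  | zero => exact absurd (hb P hP) (by push_cast at hm; linarith)
  | succ m ih =>
  by_cases ht : G.IsTop P.x (G.pivot P.x)
  swap
  · exact Submodule.mem_sup_right (Finsupp.single_mem_supported _ _ ⟨hP, ht⟩)
  set c := G.pivot P.x with hc
  have hfree := isFree_pivot (exists_isFree_of_mem hn hG hd hP)
  rw [← hc] at hfree
  set R := P.flip c with hR
  have hRfree : G.IsFree R.x c := (isFree_flip hn hG P hfree.1 c).2 hfree
  have hRtop : ¬ G.IsTop R.x c := fun h => (isTop_flip hn hfree).1 h ht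
  have hRP : R.flip c = P := Pair.flip_flip P c
  have hRpivot : G.pivot R.x = c := pivot_flip hn hG P hfree.1
  have hw : P.weight = R.weight := by rw [← hRP]; exact weight_flip hn hRfree hRtop
  have hPR : R.Arrow P := by
    rw [← hRP]
    exact Pair.arrow_of_mem_support (mem_support_diffPair_flip hn hRfree hRtop)
  have hRpos : R ∈ G.positivePairs (d - 1) := by
    refine ⟨Pair.flip_isPositive hn hG hP.1 hfree ht, ?_⟩
    have := hPR.index
    rw [hP.2] at this
    linarith
  -- Elimination: `P` is replaced, modulo a coboundary, by the other terms of the differential of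
  -- its lower partner `R`.
  have h1 : Finsupp.single P (1 : ZMod 2) = G.diff (Finsupp.single R 1) -
      (G.diffPair R).erase P := by
    rw [eq_sub_iff_add_eq, diff_single, ← hRP, ← diffPair_flip hn hRfree hRtop]
    exact Finsupp.single_add_erase _ _
  rw [h1]
  refine sub_mem (Submodule.mem_sup_left (Submodule.mem_map_of_mem
    (Finsupp.single_mem_supported _ _ hRpos))) ?_
  rw [← Finsupp.sum_single ((G.diffPair R).erase P)]
  refine sum_mem fun Q hQ => ?_
  rw [Finsupp.support_erase, Finset.mem_erase] at hQ
  have hRQ := Pair.arrow_of_mem_support hQ.2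
  have hQpos : Q ∈ G.positivePairs d :=
    ⟨hRQ.isPositive hRpos.1, by rw [hRQ.index, hRpos.2]; ring⟩
  rw [← mul_one (((G.diffPair R).erase P) Q), ← smul_eq_mul, ← Finsupp.smul_single]
  refine Submodule.smul_mem _ _ ?_
  rcases hRQ.weight_lt hn hG with h | ⟨i, hi, hit, rfl⟩
  -- `R` has the same weight as `P`, so `Q` is strictly heavier than `P` and the distance to the
  -- bound `b` has dropped.
  · exact ih Q hQpos (by rw [← hw] at h; push_cast at hm; linarith)
  · have hic : c ≠ i := by
      rintro rfl
      exact hQ.1 hRP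
    -- A flip at another free point leaves the situation at the pivot unchanged, so `Q`, like `R`,
    -- is not matched downwards.
    refine Submodule.mem_sup_right (Finsupp.single_mem_supported _ _ ⟨hQpos, ?_⟩)
    rwa [pivot_flip hn hG R hi.1, hRpivot, isTop_flip_of_ne hn hG R hi.1 hfree.1 hic]

/-- The weight is bounded above on the positive pairs of index `d` since these are finite in number,
so the elimination terminates. -/
theorem CP_le_map_sup (hn : 1 < n) (hG : G.IsSparse) {d : ℤ} (hd : d < 0) :
    G.CP d ≤ (G.CP (d - 1)).map G.diff ⊔
      Finsupp.supported (ZMod 2) (ZMod 2) (G.upperPairs d) := by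
  have hfin : (G.positivePairs d).Finite := (G.finite_setOf_index_eq d).subset fun P hP => hP.2
  obtain ⟨b, hb⟩ := (hfin.image Pair.weight).bddAbove
  have hb' : ∀ P ∈ G.positivePairs d, P.weight ≤ b := fun P hP => hb ⟨P, hP, rfl⟩
  rw [CP, Finsupp.supported_eq_span_single, Submodule.span_le]
  rintro _ ⟨P, hP, rfl⟩
  exact single_mem_map_sup hn hG hd ((b - P.weight).toNat + 1) b hb' P hP (by push_cast; omega)

/-- The differential is injective on combinations of upper pairs of negative index. -/
theorem eq_zero_of_diff_eq_zero (hn : 1 < n) (hG : G.IsSparse) {d : ℤ} (hd : d < 0)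
    {f : G.Pair →₀ ZMod 2} (hf : f ∈ Finsupp.supported (ZMod 2) (ZMod 2) (G.upperPairs d))
    (h : G.diff f = 0) : f = 0 := by
  classical
  by_contra hne
  obtain ⟨P, hP, hmin⟩ := f.support.exists_min_image Pair.weight (Finsupp.support_nonempty_iff.2 hne)
  rw [Finsupp.mem_supported] at hf
  have hPu := hf hP
  set c := G.pivot P.x with hc
  have hfree := isFree_pivot (exists_isFree_of_mem hn hG hd hPu.1)
  rw [← hc] at hfree
  -- `P` has minimal weight in the support. Another term reaching its upper partner would be
  -- strictly lighter, or a flip at a different free point of a pair that is itself top at the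
  -- pivot; both are impossible.
  have key : G.diff f (P.flip c) = f P := by
    rw [diff, Finsupp.linearCombination_apply, Finsupp.sum, Finsupp.finsetSum_apply,
      Finset.sum_eq_single_of_mem P hP]
    · rw [Finsupp.smul_apply, diffPair_flip hn hfree hPu.2, smul_eq_mul, mul_one]
    · intro R hR hRP
      rw [Finsupp.smul_apply, smul_eq_zero]
      right
      by_contra hmem
      have hRu := hf hR
      rcases (Pair.arrow_of_mem_support (Finsupp.mem_support_iff.2 hmem)).weight_lt hn hG with
        hlt | ⟨i, hi, hit, he⟩
      · rw [weight_flip hn hfree hPu.2] at hlt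
        exact (hmin R hR).not_gt hlt
      · have hp : G.pivot R.x = c := by
          rw [← pivot_flip hn hG R hi.1, ← he, pivot_flip hn hG P hfree.1]
        have htop : G.IsTop (P.flip c).x c := (isTop_flip hn hfree).2 hPu.2
        by_cases hic : c = i
        · subst hic
          refine hRP ?_
          rw [← R.flip_flip c, ← he, P.flip_flip]
        · rw [he, isTop_flip_of_ne hn hG R hi.1 hfree.1 hic] at htop
          refine hRu.2 ?_
          rwa [hp]
  rw [h, Finsupp.zero_apply] at key
  exact Finsupp.mem_support_iff.1 hP key.symm

/-- A cocycle is a coboundary plus a combination of upper pairs. The latter is again a cocycle,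
hence zero by injectivity. -/
theorem subsingleton_HP (hn : 1 < n) (hG : G.IsSparse) {d : ℤ} (hd : d < 0) :
    Subsingleton (G.HP d) := by
  rw [Submodule.Quotient.subsingleton_iff, eq_top_iff]
  rintro ⟨f, hf, hf0⟩ -
  obtain ⟨_, ⟨g, hg, rfl⟩, u, hu, rfl⟩ := Submodule.mem_sup.1 (CP_le_map_sup hn hG hd hf)
  rw [SetLike.mem_coe, LinearMap.mem_ker, map_add] at hf0
  have h0 : G.diff (G.diff g) = 0 := LinearMap.congr_fun G.diff_diff g
  rw [h0, zero_add] at hf0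
  have hu0 := eq_zero_of_diff_eq_zero hn hG hd hu hf0
  exact ⟨g, hg, by simp [hu0]⟩

end MarkedGrid

/-- For a sparse toroidal grid diagram of size `n > 1` with `k` marked `O`'s, the positive pairs
form a cochain complex, and its cohomology vanishes in degrees below `min {0, 2 - k}`. -/
theorem theorem3p3 (n : ℕ) [NeZero n] (hn : 1 < n) (G : MarkedGrid n) (hG : G.IsSparse)
    (k : ℕ) (hk : G.Z.card = k) :
    (∀ d : ℤ, ∀ f ∈ G.CP d, G.diff f ∈ G.CP (d + 1)) ∧
    G.diff ∘ₗ G.diff = 0 ∧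
    ∀ d : ℤ, d < min 0 (2 - (k : ℤ)) → Subsingleton (G.HP d) :=
  ⟨fun _ _ hf => MarkedGrid.diff_mem_CP hf, G.diff_diff,
    fun _ hd => MarkedGrid.subsingleton_HP hn hG (hd.trans_le (min_le_left _ _))⟩
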